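/- Let $\Lambda=\mathbb Z^3$ and let $\Lambda^\vee=\mathrm{Hom}(\Lambda,\mathbb Z)$; for $\delta\in\Lambda^\vee\otimes\mathbb Q$ write $\delta(x)$ also for its complex-linear extension to $x\in\mathbb C^3$. A vector $a\in\Lambda$ is primitive if $a\in k\Lambda$, $k\in\mathbb Z$, implies $k=\pm1$ (and likewise in $\Lambda^\vee$). For primitive $a$, let $H(a)=\{\alpha\in\Lambda^\vee\otimes\mathbb Q : \alpha(a)=0\}$, where a basis $\alpha,\beta$ of $H(a)$ is called oriented if $\det(\alpha,\beta,\delta)>0$ whenever $\delta(a)>0$. Let $U_a^+\subset\mathbb C^3$ be the set of $x$ such that $\mathrm{Im}\big(\alpha(x)\overline{\beta(x)}\big)>0$ for some oriented basis $\alpha,\beta$ of $H(a)$. For linearly independent primitive $a,b\in\Lambda$ let $\gamma=\gamma_{a,b}\in\Lambda^\vee$ be the unique primitive form such that $\det(a,b,\cdot)=s\gamma$ with an integer $s>0$, let $C_{+-}(a,b)=\{\delta\in\Lambda^\vee:\delta(a)>0,\ \delta(b)\le0\}$ and $C_{-+}(a,b)=\{\delta\in\Lambda^\vee:\delta(a)\le0,\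 \delta(b)>0\}$, and set, for $w\in\mathbb C$ and $x\in U_a^+\cap U_b^+$, $$\Gamma_{a,b}(w,x)=\frac{\prod_{\delta\in C_{+-}(a,b)/\mathbb Z\gamma}\big(1-e^{-2\pi i(\delta(x)-w)/\gamma(x)}\big)}{\prod_{\delta\in C_{-+}(a,b)/\mathbb Z\gamma}\big(1-e^{2\pi i(\delta(x)-w)/\gamma(x)}\big)}.$$ Set $\Gamma_{a,a}=1$. (If $b=-a$, then $U_a^+\cap U_b^+=\emptyset$ and $\Gamma_{a,b}$ is not needed.) Let $Z_{a,b}(x)=\{\delta(x):\delta\in C_{+-}(a,b)\cup C_{-+}(a,b)\}\subset\mathbb C$. **Theorem.** (1) Let $a,b\in\Lambda$ be primitive and $x\in U_a^+\cap U_b^+$. The infinite products in the definition of $\Gamma_{a,b}(w,x)$ converge unconditionally for all $w\in\mathbb C$, $\Gamma_{a,b}(\cdot,x)$ is meromorphic on $\mathbb C$, and $Z_{a,b}(x)$ is a closed discrete subset of $\mathbb C$. Moreover, as an identity of meromorphic functions of $w$, $$\Gamma_{a,b}(w,x)\,\Gamma_{b,a}(w,x)=1,$$ and it holds pointwise for all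 $w\notin Z_{a,b}(x)$. (2) Let $a,b,c\in\Lambda$ be primitive. There is a polynomial $P_{a,b,c}\in\mathbb Q(x_1,x_2,x_3)[w]$, of degree at most $3$ in $w$, such that for every $x\in U_a^+\cap U_b^+\cap U_c^+$ its coefficients have no pole at $x$ and, as an identity of meromorphic functions of $w$, $$\Gamma_{a,b}(w,x)\,\Gamma_{b,c}(w,x)\,\Gamma_{c,a}(w,x)=\exp\Big(-\frac{\pi i}{3}P_{a,b,c}(w,x)\Big),$$ which holds pointwise for all $w\notin Z_{a,b}(x)\cup Z_{b,c}(x)\cup Z_{c,a}(x)$. -/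

import Mathlib

noncomputable section

namespace GammaWedge

open scoped Matrix

/-- An element `v` of a `ℤ`-module `M` is primitive if `v ∈ k M` forces `k = ±1`. -/
def IsPrimitive {M : Type*} [AddCommGroup M] (v : M) : Prop :=
  ∀ k : ℤ, (∃ u : M, v = k • u) → k = 1 ∨ k = -1

/-- The value `α(x)` at `x ∈ ℂ³` of the linear form with coordinates `α`
(integral or rational) in the basis dual to the standard one. -/
def formEval {R : Type*} [CommRing R] [Algebra R ℂ] (α : Fin 3 → R) (x : Fin 3 → ℂ) : ℂ :=
  ∑ i, algebraMap R ℂ (α i) * x i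

/-- `α, β` is an oriented basis of the rational plane `H(a) = {α | α(a) = 0}`, where `H(a)` is
oriented so that `det(α, β, δ) > 0` whenever `δ(a) > 0`. -/
def IsOrientedBasis (a : Fin 3 → ℤ) (α β : Fin 3 → ℚ) : Prop :=
  α ⬝ᵥ (fun i => (a i : ℚ)) = 0 ∧ β ⬝ᵥ (fun i => (a i : ℚ)) = 0 ∧
  LinearIndependent ℚ ![α, β] ∧
  ∀ δ : Fin 3 → ℚ, 0 < δ ⬝ᵥ (fun i => (a i : ℚ)) → 0 < (Matrix.of ![α, β, δ]).det

/-- The domain `U_a^+ ⊆ ℂ³`: points `x` with `Im (α(x) * conj β(x)) > 0` for some oriented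
basis `α, β` of `H(a)`. -/
def UPlus (a : Fin 3 → ℤ) : Set (Fin 3 → ℂ) :=
  {x | ∃ α β : Fin 3 → ℚ, IsOrientedBasis a α β ∧
    0 < (formEval α x * (starRingEnd ℂ) (formEval β x)).im}

/-- The direction vector of the wedge `(a, b)`: the form `det(a, b, ·)`, whose coordinates are
those of the cross product, divided by the greatest common divisor of its coordinates. -/
def directionVector (a b : Fin 3 → ℤ) : Fin 3 → ℤ :=
  fun i => (a ⨯₃ b) i / Finset.univ.gcd (a ⨯₃ b)

lemma det_eq_cross (a b y : Fin 3 → ℤ) : (Matrix.of ![a, b, y]).det = (a ⨯₃ b) ⬝ᵥ y := by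
  rw [Matrix.det_fin_three]
  simp [cross_apply, dotProduct, Fin.sum_univ_three]
  ring

lemma cross_ne_zero (a b : Fin 3 → ℤ) (h : LinearIndependent ℤ ![a, b]) : a ⨯₃ b ≠ 0 := by
  intro h0
  have e0 := congrFun h0 0
  have e1 := congrFun h0 1
  have e2 := congrFun h0 2
  simp only [cross_apply, Matrix.cons_val, Pi.zero_apply] at e0 e1 e2
  rw [LinearIndependent.pair_iff] at h
  have hz : ∀ i, a i = 0 := by
    intro i
    have hi : b i • a + (-a i) • b = 0 := by
      funext j
      simp only [Pi.add_apply, Pi.smul_apply, smul_eq_mul, Pi.zero_apply]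
      fin_cases i <;> fin_cases j <;> simp <;> linarith
    simpa using (h _ _ hi).2
  have h1 := (h 1 0 (by funext j; simp [hz j])).1
  exact one_ne_zero h1

/-- For linearly independent `a, b`, the direction vector is a primitive form (hence the only
one) of which `det(a, b, ·)` is a positive integer multiple. -/
theorem directionVector_spec (a b : Fin 3 → ℤ) (h : LinearIndependent ℤ ![a, b]) :
    IsPrimitive (directionVector a b) ∧ ∃ s : ℤ, 0 < s ∧
      ∀ y : Fin 3 → ℤ, (Matrix.of ![a, b, y]).det = s * (directionVector a b ⬝ᵥ y) := by
  set g : ℤ := Finset.univ.gcd (a ⨯₃ b) with hg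
  have hne : (a ⨯₃ b) ≠ 0 := cross_ne_zero a b h
  have hg0 : g ≠ 0 := by
    intro h0
    apply hne
    funext i
    exact Finset.gcd_eq_zero_iff.mp h0 i (Finset.mem_univ i)
  have hgpos : 0 < g := 
    lt_of_le_of_ne (Int.nonneg_of_normalize_eq_self Finset.normalize_gcd) (Ne.symm hg0)
  have hmul : ∀ i, (a ⨯₃ b) i = g * directionVector a b i := fun i =>
    (Int.mul_ediv_cancel' (Finset.gcd_dvd (Finset.mem_univ i))).symm
  refine ⟨?_, g, hgpos, ?_⟩
  · rintro k ⟨u, hu⟩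
    have hd : g * k ∣ g := by
      apply Finset.dvd_gcd
      intro i _
      rw [hmul i, hu]
      exact ⟨u i, by simp [mul_assoc]⟩
    have hk : k ∣ 1 := by
      rw [← mul_dvd_mul_iff_left hg0, mul_one]
      exact hd
    exact Int.isUnit_iff.mp (isUnit_of_dvd_one hk)
  · intro y
    rw [det_eq_cross]
    simp only [dotProduct, Finset.mul_sum]
    exact Finset.sum_congr rfl fun i _ => by rw [hmul i, mul_assoc]

/-- The set `C_{+-}(a, b)` of integral forms `δ` with `δ(a) > 0` and `δ(b) ≤ 0`.
Note that `C_{-+}(a, b) = C_{+-}(b, a)`. -/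
def cone (a b : Fin 3 → ℤ) : Set (Fin 3 → ℤ) := {δ | 0 < δ ⬝ᵥ a ∧ δ ⬝ᵥ b ≤ 0}

/-- The quotient of a set `C` of forms by the translations by integer multiples of `γ`, realised
as the image of `C` in `ℤ³ / ℤγ`. -/
def orbits (C : Set (Fin 3 → ℤ)) (γ : Fin 3 → ℤ) :
    Set ((Fin 3 → ℤ) ⧸ AddSubgroup.zmultiples γ) :=
  (fun δ => (QuotientAddGroup.mk δ : (Fin 3 → ℤ) ⧸ AddSubgroup.zmultiples γ)) '' C

lemma factor_invariant (ε : ℤ) (γ δ δ' : Fin 3 → ℤ) (w : ℂ) (x : Fin 3 → ℂ)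
    (h : QuotientAddGroup.leftRel (AddSubgroup.zmultiples γ) δ δ') :
    1 - Complex.exp (ε * (2 * Real.pi * Complex.I) * (formEval δ x - w) / formEval γ x) =
    1 - Complex.exp (ε * (2 * Real.pi * Complex.I) * (formEval δ' x - w) / formEval γ x) := by
  rw [QuotientAddGroup.leftRel_apply, AddSubgroup.mem_zmultiples_iff] at h
  obtain ⟨n, hn⟩ := h
  have hδ : formEval δ' x = formEval δ x + n * formEval γ x := by
    have : δ' = δ + n • γ := by rw [hn]; abel
    subst this
    simp only [formEval, Pi.add_apply, Pi.smul_apply, smul_eq_mul, map_add, map_mul, add_mul,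
      Finset.sum_add_distrib, Finset.mul_sum, mul_assoc]
    simp
  by_cases hγ : formEval γ x = 0
  · simp [hγ]
  · congr 1
    rw [Complex.exp_eq_exp_iff_exists_int]
    refine ⟨-(ε * n), ?_⟩
    rw [hδ]
    push_cast
    field_simp
    ring

/-- The factor `1 - exp(ε 2πi (δ(x) - w) / γ(x))` attached to the class of `δ` modulo `ℤγ`. -/
def factor (ε : ℤ) (γ : Fin 3 → ℤ) (w : ℂ) (x : Fin 3 → ℂ)
    (q : (Fin 3 → ℤ) ⧸ AddSubgroup.zmultiples γ) : ℂ :=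
  Quotient.liftOn q
    (fun δ => 1 - Complex.exp
      (ε * (2 * Real.pi * Complex.I) * (formEval δ x - w) / formEval γ x))
    (fun δ δ' h => factor_invariant ε γ δ δ' w x h)

/-- The factors of the numerator of `Γ_{a,b}`, indexed by `C_{+-}(a, b) / ℤγ`. -/
def numFactor (a b : Fin 3 → ℤ) (w : ℂ) (x : Fin 3 → ℂ)
    (q : orbits (cone a b) (directionVector a b)) : ℂ :=
  factor (-1) (directionVector a b) w x q

/-- The factors of the denominator of `Γ_{a,b}`, indexed by `C_{-+}(a, b) / ℤγ`. -/
def denFactor (a b : Fin 3 → ℤ) (w : ℂ) (x : Fin 3 → ℂ)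
    (q : orbits (cone b a) (directionVector a b)) : ℂ :=
  factor 1 (directionVector a b) w x q

open scoped Classical in
/-- The gamma function `Γ_{a,b}(w, x)` of the wedge `(a, b)`; it is used only for
`x ∈ U_a^+ ∩ U_b^+`, a set that is empty if `b = -a`. -/
def Gam (a b : Fin 3 → ℤ) (w : ℂ) (x : Fin 3 → ℂ) : ℂ :=
  if a = b then 1 else (∏' q, numFactor a b w x q) / (∏' q, denFactor a b w x q)

/-- The set of zeros and poles in `w` of `Γ_{a,b}(·, x)`, that is, the set of points `δ(x)` with
`δ ∈ C_{+-}(a, b) ∪ C_{-+}(a, b)` (this union is stable under translation by `ℤγ`). -/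
def zerosPoles (a b : Fin 3 → ℤ) (x : Fin 3 → ℂ) : Set ℂ :=
  {w | ∃ δ ∈ cone a b ∪ cone b a, w = formEval δ x}

/-- The field `ℚ(x₁, x₂, x₃)` of rational functions. -/
abbrev RatFun : Type := FractionRing (MvPolynomial (Fin 3) ℚ)

/-- The rational function `f` (in lowest terms) has no pole at `x`. -/
def RatFun.RegularAt (f : RatFun) (x : Fin 3 → ℂ) : Prop :=
  MvPolynomial.aeval x (IsFractionRing.den (MvPolynomial (Fin 3) ℚ) f : MvPolynomial (Fin 3) ℚ) ≠ 0

/-- The value of the rational function `f` at `x`, meaningful where `f` is regular. -/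
def RatFun.value (f : RatFun) (x : Fin 3 → ℂ) : ℂ :=
  MvPolynomial.aeval x (IsFractionRing.num (MvPolynomial (Fin 3) ℚ) f) /
    MvPolynomial.aeval x
      (IsFractionRing.den (MvPolynomial (Fin 3) ℚ) f : MvPolynomial (Fin 3) ℚ)

/-- The value `P(w, x)` of a polynomial `P ∈ ℚ(x₁, x₂, x₃)[w]`. -/
def polyValue (P : Polynomial RatFun) (w : ℂ) (x : Fin 3 → ℂ) : ℂ :=
  P.sum fun k f => RatFun.value f x * w ^ k

end GammaWedge

end

/-! The positivity of Im(α(x) conj β(x)) is first replaced by `wt a x > 0`, a condition linear in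
`a` (`wt_pos`). Under it both products of a wedge are dominated by a double geometric series, so
numerator and denominator are entire in w with the expected zeros. Exchanging `a` and `b` changes
the sign of the direction vector and swaps the two products, which gives the two term relation.

For the three term relation let det(a,b,c) > 0, and let α, β, γ be the direction vectors of (b,c),
(c,a), (a,b). They are positive multiples of the dual basis. The cone of (a,b) modulo γ is the
disjoint union of the translates δ + mα - (n+1)β, m, n ≥ 0, where δ runs through the finitely many
lattice points of a half-open box. The same box serves (b,c) and (c,a). Near w = 0, taking
logarithms and summing geometric series makes Γ_{a,b} the exponential of 2πi times the sum over the
box of the residues of exp(tz) / (t ∏ (1 - exp(-t o_k))), z = w - δ(x), at its poles in 2πiℤ/γ(x)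
other than 0 (`eventually_Gam_eq_exp`). Here the o_k are α(x), β(x), γ(x), and the other two gamma
functions supply the other two lines of poles.

All residues sum to zero if z is minus a combination of the o_k with coefficients in (0,1), because
the integrals over suitable large circles then tend to zero (`sum_tsum_resTerm`). So the product of
the three gamma functions is governed by the residue at the origin, a cubic in z over the product of
the periods. Box points only have coefficients in (0,1], but the o_k satisfy a linear relation with
positive real coefficients, which moves the coefficients into the open interval and leaves room for
small w (`eventually_exists_coeff`). The identity near w = 0 extends by analytic continuation.

Negative orientation reduces to this case by inverting every factor. For coplanar vectors the
positivity of `wt` puts one of them between the other two, the cones are additive, and the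
polynomial is zero. -/

namespace GammaWedge

/-! ### Residues on a disc, bounds for 1 - exp(-u), and radii avoiding arithmetic progressions -/

section

open Filter Topology Asymptotics Complex

/-- If `f` is holomorphic on a closed disc up to finitely many points, and at each of them
differs from a function `p i`, holomorphic elsewhere, by a function with a limit, then the integral
of `f` along the circle is the sum of those of the `p i`. -/
theorem circleIntegral_eq_sum_of_tendsto {ι : Type*} (T : Finset ι) (s : ι → ℂ) (f : ℂ → ℂ)
    (p : ι → ℂ → ℂ) {R : ℝ} (hR : 0 < R) (hs : ∀ i ∈ T, s i ∈ Metric.ball (0 : ℂ) R)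
    (hinj : Set.InjOn s T)
    (hf : ∀ t ∈ Metric.closedBall (0 : ℂ) R, (∀ i ∈ T, t ≠ s i) → DifferentiableAt ℂ f t)
    (hp : ∀ i ∈ T, ∀ t, t ≠ s i → DifferentiableAt ℂ (p i) t)
    (hl : ∀ i ∈ T, ∃ L, Tendsto (fun t => f t - p i t) (𝓝[≠] (s i)) (𝓝 L)) :
    (∮ t in C(0, R), f t) = ∑ i ∈ T, ∮ t in C(0, R), p i t := by
  classical
  set S : Finset ℂ := T.image s with hS
  set h : ℂ → ℂ := fun t => f t - ∑ i ∈ T, p i t with hh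
  have hSt : ∀ t, t ∉ S → ∀ i ∈ T, t ≠ s i := fun t ht i hi hti =>
    ht (Finset.mem_image.2 ⟨i, hi, hti.symm⟩)
  have hdiff : ∀ t ∈ Metric.closedBall (0 : ℂ) R, t ∉ S → DifferentiableAt ℂ h t := by
    intro t ht htS
    exact (hf t ht (hSt t htS)).sub
      (DifferentiableAt.fun_sum fun i hi => hp i hi t (hSt t htS i hi))
  have hlim : ∀ t ∈ S, ∃ L, Tendsto h (𝓝[≠] t) (𝓝 L) := by
    intro t ht
    obtain ⟨i, hi, rfl⟩ := Finset.mem_image.1 ht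
    obtain ⟨L, hL⟩ := hl i hi
    have h2 : Tendsto (fun t => ∑ j ∈ T.erase i, p j t) (𝓝[≠] (s i))
        (𝓝 (∑ j ∈ T.erase i, p j (s i))) := by
      have : ContinuousAt (fun t => ∑ j ∈ T.erase i, p j t) (s i) := by
        refine (DifferentiableAt.fun_sum (𝕜 := ℂ) fun j hj => ?_).continuousAt
        obtain ⟨hji, hjT⟩ := Finset.mem_erase.1 hj
        exact hp j hjT _ fun h => hji (hinj hjT hi h.symm)
      exact this.tendsto.mono_left nhdsWithin_le_nhds
    refine ⟨_, (hL.sub h2).congr fun t => ?_⟩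
    simp only [hh]
    rw [← Finset.add_sum_erase T _ hi]
    ring
  -- The singularities of `h` are filled in with its limits: Cauchy's theorem on the disc needs only
  -- continuity at finitely many exceptional points.
  set g : ℂ → ℂ := fun t => if t ∈ S then limUnder (𝓝[≠] t) h else h t with hg
  have hgh : ∀ t, ∀ᶠ u in 𝓝[≠] t, g u = h u := by
    intro t
    have h3 : ∀ᶠ u in 𝓝[≠] t, u ∈ ((S : Set ℂ) \ {t})ᶜ :=
      nhdsWithin_le_nhds
        ((S.finite_toSet.subset Set.sdiff_subset).isClosed.isOpen_compl.mem_nhds (by simp))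
    have : ∀ᶠ u in 𝓝[≠] t, u ∉ S := by
      filter_upwards [h3, self_mem_nhdsWithin] with u hu hut hus
      exact hu ⟨hus, hut⟩
    filter_upwards [this] with u hu
    simp [hg, hu]
  have hgd : ∀ t ∈ Metric.closedBall (0 : ℂ) R, t ∉ S → DifferentiableAt ℂ g t := by
    intro t ht htS
    refine (hdiff t ht htS).congr_of_eventuallyEq ?_
    have : ∀ᶠ u in 𝓝 t, u ∈ ((S : Set ℂ))ᶜ := S.finite_toSet.isClosed.isOpen_compl.mem_nhds htS
    filter_upwards [this] with u hu
    have hu' : u ∉ S := hu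
    simp [hg, hu']
  have hgc : ∀ t ∈ Metric.closedBall (0 : ℂ) R, ContinuousAt g t := by
    intro t ht
    by_cases htS : t ∈ S
    · rw [continuousAt_iff_punctured_nhds]
      have h1 : g t = limUnder (𝓝[≠] t) h := by simp [hg, htS]
      rw [h1]
      exact (tendsto_nhds_limUnder (hlim t htS)).congr' ((hgh t).mono fun u hu => hu.symm)
    · exact (hgd t ht htS).continuousAt
  have hg0 : (∮ t in C(0, R), g t) = 0 := by
    refine circleIntegral_eq_zero_of_differentiable_on_off_countable hR.le
      (S.finite_toSet.countable) (fun t ht => (hgc t ht).continuousWithinAt) ?_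
    rintro t ⟨ht, htS⟩
    exact hgd t (Metric.ball_subset_closedBall ht) htS
  have hsph : ∀ t ∈ Metric.sphere (0 : ℂ) R, t ∉ S := by
    intro t ht htS
    obtain ⟨i, hi, rfl⟩ := Finset.mem_image.1 htS
    have := hs i hi
    rw [Metric.mem_ball] at this
    rw [Metric.mem_sphere] at ht
    linarith
  have hgh2 : (∮ t in C(0, R), g t) = ∮ t in C(0, R), h t := by
    refine circleIntegral.integral_congr hR.le fun t ht => ?_
    simp [hg, hsph t ht]
  have hfi : CircleIntegrable f 0 R := by
    refine ContinuousOn.circleIntegrable hR.le fun t ht => ?_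
    exact (hf t (Metric.sphere_subset_closedBall ht)
      (hSt t (hsph t ht))).continuousAt.continuousWithinAt
  have hpi : ∀ i ∈ T, CircleIntegrable (p i) 0 R := by
    intro i hi
    refine ContinuousOn.circleIntegrable hR.le fun t ht => ?_
    exact (hp i hi t (hSt t (hsph t ht) i hi)).continuousAt.continuousWithinAt
  rw [hgh2, hh, circleIntegral.integral_sub hfi (CircleIntegrable.fun_sum _ hpi),
    circleIntegral.integral_fun_sum hpi] at hg0
  exact sub_eq_zero.1 hg0

/-- For |Re u| ≥ 1 one of the two terms dominates. Otherwise the period 2πi brings u into a compact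
rectangle minus a disc about 0, the only zero in it, and compactness gives a bound. -/
theorem exists_lower_bound_one_sub_exp {ε : ℝ} (hε : 0 < ε) :
    ∃ m > 0, ∀ u : ℂ, (∀ j : ℤ, ε ≤ ‖u - j * (2 * Real.pi * I)‖) →
      m * max 1 (Real.exp (-u.re)) ≤ ‖1 - exp (-u)‖ := by
  set K : Set ℂ := (Set.Icc (-1) 1 ×ℂ Set.Icc (-Real.pi) Real.pi) ∩ {u | ε ≤ ‖u‖} with hK
  have hKc : IsCompact K :=
    (isCompact_Icc.reProdIm isCompact_Icc).inter_right
      (isClosed_le continuous_const continuous_norm)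
  obtain ⟨m₀, hm₀, hm₀K⟩ : ∃ m > 0, ∀ u ∈ K, m ≤ ‖1 - exp (-u)‖ := by
    refine hKc.exists_forall_le' (a := 0) (by fun_prop) ?_
    rintro u ⟨hu, hu2⟩
    rw [norm_pos_iff, sub_ne_zero]
    intro h
    obtain ⟨n, hn⟩ := exp_eq_one_iff.1 h.symm
    have h1 := hu.2
    have h2 : u = -(n * (2 * Real.pi * I)) := by rw [← hn]; ring
    have h3 : u.im = -(n * (2 * Real.pi)) := by rw [h2]; simp
    have hn0 : n = 0 := by
      rw [Set.mem_preimage, h3, Set.mem_Icc] at h1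
      have hpi := Real.pi_pos
      have a1 : (n : ℝ) < 1 := by nlinarith
      have a2 : (-1 : ℝ) < n := by nlinarith
      have a1' : n < 1 := by exact_mod_cast a1
      have a2' : -1 < n := by exact_mod_cast a2
      omega
    rw [hn0] at h2
    simp only [Set.mem_ofPred_eq, h2] at hu2
    simp at hu2
    linarith
  have he1 : Real.exp (-1) < 1 := by rw [Real.exp_lt_one_iff]; norm_num
  refine ⟨min (m₀ / Real.exp 1) (1 - Real.exp (-1)),
    lt_min (by positivity) (by linarith), fun u hu => ?_⟩
  have hnorm : ‖exp (-u)‖ = Real.exp (-u.re) := by rw [norm_exp]; simp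
  rcases le_or_gt 1 u.re with h1 | h1
  · have h2 : Real.exp (-u.re) ≤ Real.exp (-1) := Real.exp_le_exp.2 (by linarith)
    rw [max_eq_left (by linarith), mul_one]
    refine (min_le_right _ _).trans ?_
    have := norm_sub_norm_le (1 : ℂ) (exp (-u))
    rw [hnorm, norm_one] at this
    linarith
  rcases le_or_gt u.re (-1) with h3 | h3
  · have h2 : 1 ≤ Real.exp (-1) * Real.exp (-u.re) := by
      rw [← Real.exp_add]; exact Real.one_le_exp (by linarith)
    have h4 : 1 ≤ Real.exp (-u.re) := Real.one_le_exp (by linarith)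
    rw [max_eq_right h4]
    have := norm_sub_norm_le (exp (-u)) 1
    rw [hnorm, norm_one, norm_sub_rev] at this
    have h5 : min (m₀ / Real.exp 1) (1 - Real.exp (-1)) * Real.exp (-u.re) ≤
      (1 - Real.exp (-1)) * Real.exp (-u.re) := by gcongr; exact min_le_right _ _
    linarith
  · obtain ⟨j, hj1, hj2⟩ : ∃ j : ℤ, -Real.pi ≤ u.im - j * (2 * Real.pi) ∧
        u.im - j * (2 * Real.pi) ≤ Real.pi := by
      refine ⟨round (u.im / (2 * Real.pi)), ?_⟩
      have h := abs_sub_round (u.im / (2 * Real.pi))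
      rw [abs_le] at h
      have hpi := Real.pi_pos
      have e : u.im = u.im / (2 * Real.pi) * (2 * Real.pi) := by field_simp
      constructor <;> nlinarith
    have hmem : u - j * (2 * Real.pi * I) ∈ K := by
      refine ⟨?_, hu j⟩
      rw [Complex.mem_reProdIm]
      constructor
      · simp; constructor <;> linarith
      · simp; constructor <;> linarith
    have h5 := hm₀K _ hmem
    have h6 : exp (-(u - j * (2 * Real.pi * I))) = exp (-u) := by
      rw [exp_eq_exp_iff_exists_int]; exact ⟨j, by ring⟩
    rw [h6] at h5
    refine le_trans ?_ h5
    have h7 : max 1 (Real.exp (-u.re)) ≤ Real.exp 1 :=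
      max_le (Real.one_le_exp (by norm_num)) (Real.exp_le_exp.2 (by linarith))
    calc _ ≤ m₀ / Real.exp 1 * Real.exp 1 :=
          mul_le_mul (min_le_left _ _) h7 (by positivity) (by positivity)
      _ = m₀ := by field_simp

/-- The quotient decays like exp(-s Re u) to the right and like exp((1 - s) Re u) to the left; this
is where 0 < s < 1 enters. -/
theorem exists_upper_bound_exp_div {s ε : ℝ} (hs0 : 0 < s) (hs1 : s < 1) (hε : 0 < ε) :
    ∃ C > 0, ∃ c > 0, ∀ u : ℂ, (∀ j : ℤ, ε ≤ ‖u - j * (2 * Real.pi * I)‖) →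
      ‖exp (-(s * u)) / (1 - exp (-u))‖ ≤ C * Real.exp (-(c * |u.re|)) := by
  obtain ⟨m, hm, hb⟩ := exists_lower_bound_one_sub_exp hε
  refine ⟨m⁻¹, inv_pos.2 hm, min s (1 - s), lt_min hs0 (by linarith), fun u hu => ?_⟩
  have h1 := hb u hu
  have h2 : ‖exp (-(s * u))‖ = Real.exp (-(s * u.re)) := by rw [norm_exp]; simp
  rw [norm_div, h2, div_le_iff₀ (lt_of_lt_of_le (by positivity) h1)]
  refine le_trans ?_ (mul_le_mul_of_nonneg_left h1 (by positivity))
  rw [mul_comm m⁻¹, mul_assoc, inv_mul_cancel_left₀ hm.ne']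
  rcases le_total 0 u.re with h | h
  · refine le_trans ?_ (mul_le_mul_of_nonneg_left (le_max_left _ _) (by positivity))
    rw [mul_one, abs_of_nonneg h]
    exact Real.exp_le_exp.2 (by nlinarith [min_le_left s (1 - s)])
  · refine le_trans ?_ (mul_le_mul_of_nonneg_left (le_max_right _ _) (by positivity))
    rw [← Real.exp_add, abs_of_nonpos h]
    exact Real.exp_le_exp.2 (by nlinarith [min_le_right s (1 - s)])

/-- An interval shorter than the spacing ρ cannot be obstructed twice: either the second fifth is
far from every multiple of ρ, or some multiple lies near it and then the fourth fifth is free. -/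
theorem exists_subinterval_far {ρ A ℓ : ℝ} (hℓ : 0 < ℓ) (hρ : ℓ < ρ) :
    ∃ A', A ≤ A' ∧ A' + ℓ / 5 ≤ A + ℓ ∧
      ∀ r ∈ Set.Icc A' (A' + ℓ / 5), ∀ j : ℤ, ℓ / 10 ≤ |r - j * ρ| := by
  by_cases h : ∃ j : ℤ, |A + 3 * ℓ / 10 - j * ρ| < ℓ / 5
  · obtain ⟨j, hj⟩ := h
    refine ⟨A + 3 * ℓ / 5, by linarith, by linarith, fun r hr i => ?_⟩
    rw [abs_lt] at hj
    by_contra hc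
    rw [not_le, abs_lt] at hc
    have h1 : ((i - j : ℤ) : ℝ) * ρ < 1 * ρ := by push_cast; linarith [hr.1, hr.2]
    have h2 : 0 * ρ < ((i - j : ℤ) : ℝ) * ρ := by push_cast; linarith [hr.1, hr.2]
    have hρ0 : 0 < ρ := hℓ.trans hρ
    have h1 := lt_of_mul_lt_mul_right h1 hρ0.le
    have h2 := lt_of_mul_lt_mul_right h2 hρ0.le
    have h1 : i - j < 1 := by exact_mod_cast h1
    have h2 : 0 < i - j := by exact_mod_cast h2
    omega
  · push Not at h
    refine ⟨A + ℓ / 5, by linarith, by linarith, fun r hr i => ?_⟩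
    have h1 := h i
    have h2 : |r - (A + 3 * ℓ / 10)| ≤ ℓ / 10 := by
      rw [abs_le]; constructor <;> linarith [hr.1, hr.2]
    have h3 : A + 3 * ℓ / 10 - i * ρ = (r - i * ρ) - (r - (A + 3 * ℓ / 10)) := by ring
    rw [h3] at h1
    have := abs_sub (r - i * ρ) (r - (A + 3 * ℓ / 10))
    linarith

/-- Supplies arbitrarily large circles whose radii keep a uniform distance from the moduli of all
poles, one progression of moduli for each period. -/
theorem exists_radius_far {n : ℕ} (ρ : Fin n → ℝ) (hρ : ∀ k, 0 < ρ k) :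
    ∃ ε > 0, ∀ M : ℝ, ∃ R, M ≤ R ∧ ∀ k, ∀ j : ℤ, ε ≤ |R - j * ρ k| := by
  -- The induction provides a whole interval of good radii, as short as desired, so that it can be
  -- made shorter than the spacing of the next progression.
  suffices ∀ ℓ₀ > 0, ∃ ε > 0, ∃ ℓ > 0, ℓ ≤ ℓ₀ ∧ ∀ A : ℝ, ∃ A', A ≤ A' ∧
      ∀ r ∈ Set.Icc A' (A' + ℓ), ∀ k, ∀ j : ℤ, ε ≤ |r - j * ρ k| by
    obtain ⟨ε, hε, ℓ, hℓ, -, h⟩ := this 1 one_pos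
    refine ⟨ε, hε, fun M => ?_⟩
    obtain ⟨A', hA, h⟩ := h M
    exact ⟨A', hA, h A' ⟨le_rfl, by linarith⟩⟩
  induction n with
  | zero =>
    intro ℓ hℓ
    exact ⟨1, one_pos, ℓ, hℓ, le_rfl, fun A => ⟨A, le_rfl, fun r _ k => k.elim0⟩⟩
  | succ n ih =>
    intro ℓ₀ hℓ₀
    have hmin : 0 < min ℓ₀ (ρ 0 / 2) := lt_min hℓ₀ (by linarith [hρ 0])
    obtain ⟨ε, hε, ℓ, hℓ, hle, h⟩ := ih (fun k => ρ k.succ) (fun k => hρ _) _ hmin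
    have hlρ : ℓ < ρ 0 := by linarith [min_le_right ℓ₀ (ρ 0 / 2), hρ 0]
    refine ⟨min ε (ℓ / 10), lt_min hε (by linarith), ℓ / 5, by linarith,
      by linarith [min_le_left ℓ₀ (ρ 0 / 2)], fun A => ?_⟩
    obtain ⟨A₁, hA₁, h₁⟩ := h A
    obtain ⟨A₂, hA₂, hA₂', h₂⟩ := exists_subinterval_far (A := A₁) hℓ hlρ
    refine ⟨A₂, hA₁.trans hA₂, fun r hr k j => ?_⟩
    refine Fin.cases ?_ (fun k => ?_) k
    · exact (min_le_right _ _).trans (h₂ r hr j)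
    · exact (min_le_left _ _).trans (h₁ r ⟨hA₂.trans hr.1, hr.2.trans hA₂'⟩ k j)

end

/-! ### The Laurent expansion of the kernel at the origin -/

section

open Filter Topology Asymptotics Complex

/-- `F` agrees with the cubic polynomial with coefficients `a` up to order four at the origin. -/
def CubicJet (F : ℂ → ℂ) (a₀ a₁ a₂ a₃ : ℂ) : Prop :=
  (fun t => F t - (a₀ + a₁ * t + a₂ * t ^ 2 + a₃ * t ^ 3)) =O[𝓝[≠] 0] fun t => t ^ 4

theorem isBigO_one_of_continuous {g : ℂ → ℂ} (hg : Continuous g) :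
    g =O[𝓝[≠] (0 : ℂ)] fun _ => (1 : ℂ) :=
  (hg.continuousAt.tendsto.mono_left nhdsWithin_le_nhds).isBigO_one ℂ

theorem CubicJet.isBigO_one {F : ℂ → ℂ} {a₀ a₁ a₂ a₃ : ℂ} (h : CubicJet F a₀ a₁ a₂ a₃) :
    F =O[𝓝[≠] 0] fun _ => (1 : ℂ) := by
  have h1 : (fun t : ℂ => t ^ 4) =O[𝓝[≠] 0] fun _ => (1 : ℂ) :=
    isBigO_one_of_continuous (by fun_prop)
  have h2 := (h.trans h1).add (isBigO_one_of_continuous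
    (g := fun t => a₀ + a₁ * t + a₂ * t ^ 2 + a₃ * t ^ 3) (by fun_prop))
  simpa using h2

theorem CubicJet.mul {F G : ℂ → ℂ} {a₀ a₁ a₂ a₃ b₀ b₁ b₂ b₃ : ℂ} (hF : CubicJet F a₀ a₁ a₂ a₃)
    (hG : CubicJet G b₀ b₁ b₂ b₃) :
    CubicJet (fun t => F t * G t) (a₀ * b₀) (a₀ * b₁ + a₁ * b₀) (a₀ * b₂ + a₁ * b₁ + a₂ * b₀)
      (a₀ * b₃ + a₁ * b₂ + a₂ * b₁ + a₃ * b₀) := by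
  have h1 := IsBigO.mul hF hG.isBigO_one
  have h2 := (isBigO_one_of_continuous
    (g := fun t => a₀ + a₁ * t + a₂ * t ^ 2 + a₃ * t ^ 3) (by fun_prop)).mul hG
  -- These are the terms of degree 4 to 6 in the product of the two cubic polynomials.
  have h3 := (isBigO_refl (fun t : ℂ => t ^ 4) (𝓝[≠] 0)).mul (isBigO_one_of_continuous
    (g := fun t => (a₁ * b₃ + a₂ * b₂ + a₃ * b₁) + (a₂ * b₃ + a₃ * b₂) * t + a₃ * b₃ * t ^ 2)
    (by fun_prop))
  simp only [mul_one, one_mul] at h1 h2 h3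
  refine ((h1.add h2).add h3).congr_left fun t => ?_
  ring

theorem CubicJet.congr {F G : ℂ → ℂ} {a₀ a₁ a₂ a₃ : ℂ} (hF : CubicJet F a₀ a₁ a₂ a₃)
    (h : F =ᶠ[𝓝[≠] 0] G) : CubicJet G a₀ a₁ a₂ a₃ :=
  IsBigO.congr' hF (h.mono fun t ht => by simp [ht]) EventuallyEq.rfl

theorem cubicJet_exp (z : ℂ) :
    CubicJet (fun t => exp (t * z)) 1 z (z ^ 2 / 2) (z ^ 3 / 6) := by
  have h := (exp_sub_sum_range_isBigO_pow 4).comp_tendsto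
    (k := fun t : ℂ => t * z) (l' := 𝓝[≠] (0 : ℂ)) (by
      have : ContinuousAt (fun t : ℂ => t * z) 0 := by fun_prop
      simpa [ContinuousAt] using this.tendsto.mono_left nhdsWithin_le_nhds)
  have h2 : ((fun t : ℂ => t ^ 4) ∘ fun t : ℂ => t * z) =O[𝓝[≠] (0 : ℂ)] fun t => t ^ 4 := by
    refine ((isBigO_refl (fun t : ℂ => t ^ 4) _).const_mul_left (z ^ 4)).congr_left fun t => ?_
    simp only [Function.comp]; ring
  refine (h.trans h2).congr_left fun t => ?_
  simp [Finset.sum_range_succ, Nat.factorial]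
  ring

/-- The Todd series, whose coefficients are Bernoulli numbers. The claimed jet is multiplied by the
expansion of 1 - exp(-to) to order five, compared with t, and divided back. -/
theorem cubicJet_todd {o : ℂ} (ho : o ≠ 0) :
    CubicJet (fun t => t / (1 - exp (-(t * o)))) (1 / o) (1 / 2) (o / 12) 0 := by
  have h := (exp_sub_sum_range_isBigO_pow 5).comp_tendsto
    (k := fun t : ℂ => -(t * o)) (l' := 𝓝[≠] (0 : ℂ)) (by
      have : ContinuousAt (fun t : ℂ => -(t * o)) 0 := by fun_prop
      simpa [ContinuousAt] using this.tendsto.mono_left nhdsWithin_le_nhds)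
  have hne : ∀ᶠ t : ℂ in 𝓝[≠] 0, t ≠ 0 := self_mem_nhdsWithin
  have hd : HasDerivAt (fun t : ℂ => 1 - exp (-(t * o))) o 0 := by
    have := (((hasDerivAt_id (0 : ℂ)).mul_const o).neg.cexp).const_sub 1
    simpa using this
  have hG : Tendsto (fun t : ℂ => t / (1 - exp (-(t * o)))) (𝓝[≠] 0) (𝓝 o⁻¹) := by
    refine ((hasDerivAt_iff_tendsto_slope.1 hd).inv₀ ho).congr fun t => ?_
    simp [slope_def_field]
  have hden : ∀ᶠ t : ℂ in 𝓝[≠] 0, 1 - exp (-(t * o)) ≠ 0 := by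
    filter_upwards [hG.eventually_ne (inv_ne_zero ho)] with t ht h0
    exact ht (by simp [h0])
  have h1 : (fun t : ℂ => (1 - exp (-(t * o)) - (o * t - o ^ 2 * t ^ 2 / 2 + o ^ 3 * t ^ 3 / 6
      - o ^ 4 * t ^ 4 / 24))) =O[𝓝[≠] (0 : ℂ)] fun t => t ^ 5 := by
    have h2 : ((fun t : ℂ => t ^ 5) ∘ fun t : ℂ => -(t * o)) =O[𝓝[≠] (0 : ℂ)] fun t => t ^ 5 := by
      refine ((isBigO_refl (fun t : ℂ => t ^ 5) _).const_mul_left (-o ^ 5)).congr_left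
        fun t => ?_
      simp only [Function.comp]; ring
    refine (h.trans h2).neg_left.congr_left fun t => ?_
    simp [Finset.sum_range_succ, Nat.factorial]
    ring
  have h3 := h1.mul (isBigO_one_of_continuous
    (g := fun t => 1 / o + 1 / 2 * t + o / 12 * t ^ 2) (by fun_prop))
  -- The truncated factors multiply to t plus exactly these terms of degree 5 and 6.
  have h4 := (isBigO_refl (fun t : ℂ => t ^ 5) (𝓝[≠] 0)).mul (isBigO_one_of_continuous
    (g := fun t => (-o ^ 4 / 144 - o ^ 5 / 288 * t)) (by fun_prop))
  simp only [mul_one] at h3 h4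
  have h5 := (hG.isBigO_one ℂ).mul (h3.add h4).neg_left
  have h6 : (fun t : ℂ => (1 : ℂ) * t ^ 5) =O[𝓝[≠] (0 : ℂ)] fun t => t * t ^ 4 :=
    (isBigO_refl _ _).congr_left fun t => by ring
  have h7 := (isBigO_refl (fun t : ℂ => t⁻¹) (𝓝[≠] 0)).mul (h5.trans h6)
  refine (h7.congr' ?_ ?_)
  · filter_upwards [hne, hden] with t ht ht2
    field_simp
    ring
  · filter_upwards [hne] with t ht
    field_simp

/-- The function whose residues are the terms in the expansions of the logarithms of the gamma
functions. -/
noncomputable def kern (o : Fin 3 → ℂ) (z t : ℂ) : ℂ := exp (t * z) / (t * ∏ k, (1 - exp (-(t * o k))))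

/-- The residue of `kern o z` at `2πij/o k`. -/
noncomputable def resTerm (o : Fin 3 → ℂ) (z : ℂ) (k : Fin 3) (j : ℤ) : ℂ :=
  exp (2 * Real.pi * I * j / o k * z) /
    (2 * Real.pi * I * j * ∏ l ∈ Finset.univ.erase k, (1 - exp (-(2 * Real.pi * I * j / o k * o l))))

/-- The product of the periods with the residue of `kern o z` at the origin. -/
def resNum {R : Type*} [CommRing R] [Algebra ℚ R] (o : Fin 3 → R) (z : R) : R :=
  algebraMap ℚ R (1 / 6) * z ^ 3 + algebraMap ℚ R (1 / 4) * (o 0 + o 1 + o 2) * z ^ 2 +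
  algebraMap ℚ R (1 / 12) * (o 0 ^ 2 + o 1 ^ 2 + o 2 ^ 2 +
    3 * (o 0 * o 1 + o 0 * o 2 + o 1 * o 2)) * z +
  algebraMap ℚ R (1 / 24) * ((o 0 + o 1 + o 2) * (o 0 * o 1 + o 0 * o 2 + o 1 * o 2))

/-- The pole at the origin has order four, so the residue is the t³ coefficient of t⁴ times the
kernel, which is an exponential times three Todd series. -/
theorem exists_cubicJet_kern (o : Fin 3 → ℂ) (ho : ∀ k, o k ≠ 0) (z : ℂ) :
    ∃ e₀ e₁ e₂ e₃ : ℂ, e₃ = resNum o z / (o 0 * o 1 * o 2) ∧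
      CubicJet (fun t => t ^ 4 * kern o z t) e₀ e₁ e₂ e₃ := by
  have h := (((cubicJet_exp z).mul (cubicJet_todd (ho 0))).mul (cubicJet_todd (ho 1))).mul
    (cubicJet_todd (ho 2))
  refine ⟨_, _, _, _, ?_, h.congr ?_⟩
  · have := ho 0
    have := ho 1
    have := ho 2
    simp only [resNum, eq_ratCast]
    push_cast
    field_simp
    ring
  · filter_upwards [self_mem_nhdsWithin] with t (ht : t ≠ 0)
    simp only [kern, Fin.prod_univ_three]
    simp only [div_eq_mul_inv, mul_inv]
    field_simp

end

/-! ### Poles and residues of the kernel -/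

section

open Filter Topology Asymptotics Complex

/-- The complex numbers `o k` are pairwise linearly independent over the reals. -/
def PairIndep (o : Fin 3 → ℂ) : Prop :=
  ∀ k l, k ≠ l → (o k * (starRingEnd ℂ) (o l)).im ≠ 0

theorem PairIndep.ne_zero {o : Fin 3 → ℂ} (h : PairIndep o) (k : Fin 3) : o k ≠ 0 := by
  intro h0
  have := h k (k + 1) (by fin_cases k <;> decide)
  simp [h0] at this

theorem one_sub_exp_neg_eq_zero {u : ℂ} (h : 1 - exp (-u) = 0) :
    ∃ j : ℤ, u = 2 * Real.pi * I * j := by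
  obtain ⟨n, hn⟩ := exp_eq_one_iff.1 (sub_eq_zero.1 h).symm
  refine ⟨-n, ?_⟩
  rw [← neg_inj, hn]
  push_cast
  ring

theorem two_pi_I_mul_int_ne_zero {j : ℤ} (hj : j ≠ 0) : 2 * (Real.pi : ℂ) * I * j ≠ 0 := by
  simp [hj, Real.pi_ne_zero]

theorem PairIndep.mul_ne {o : Fin 3 → ℂ} (h : PairIndep o) {k l : Fin 3} (hkl : l ≠ k) {i j : ℤ}
    (hj : j ≠ 0) : (j : ℂ) * o l ≠ i * o k := by
  intro h0
  apply h l k hkl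
  have h1 := congrArg (fun u => (u * (starRingEnd ℂ) (o k)).im) h0
  simp only [mul_assoc, mul_conj] at h1
  rw [← ofReal_intCast, ← ofReal_intCast, im_ofReal_mul, im_ofReal_mul] at h1
  simpa [hj] using h1

theorem PairIndep.pole_ne {o : Fin 3 → ℂ} (h : PairIndep o) {k l : Fin 3} (hkl : l ≠ k) {j : ℤ}
    (hj : j ≠ 0) : 1 - exp (-(2 * Real.pi * I * j / o k * o l)) ≠ 0 := by
  intro h0
  obtain ⟨n, hn⟩ := one_sub_exp_neg_eq_zero h0
  apply h.mul_ne hkl (i := n) hj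
  have := h.ne_zero k
  field_simp at hn
  have hpi : (Real.pi : ℂ) ≠ 0 := by exact_mod_cast Real.pi_ne_zero
  linear_combination hn

/-- The three lines of poles meet only at the origin, so every other pole is simple. -/
theorem PairIndep.pole_injective {o : Fin 3 → ℂ} (h : PairIndep o) {k l : Fin 3} {i j : ℤ}
    (hj : j ≠ 0) (he : 2 * (Real.pi : ℂ) * I * i / o l = 2 * Real.pi * I * j / o k) :
    l = k ∧ i = j := by
  have hk := h.ne_zero k
  have hl := h.ne_zero l
  have hpi : (Real.pi : ℂ) ≠ 0 := by exact_mod_cast Real.pi_ne_zero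
  field_simp at he
  have hlk : l = k := by
    by_contra hlk
    exact h.mul_ne hlk (i := i) hj (by linear_combination -he)
  refine ⟨hlk, ?_⟩
  subst hlk
  have := mul_left_cancel₀ hk ((mul_comm _ _).trans he)
  exact_mod_cast this

theorem differentiableAt_kern {o : Fin 3 → ℂ} (ho : ∀ k, o k ≠ 0) (z : ℂ) {t : ℂ} (ht : t ≠ 0)
    (h : ∀ k, ∀ j : ℤ, j ≠ 0 → t ≠ 2 * Real.pi * I * j / o k) :
    DifferentiableAt ℂ (kern o z) t := by
  unfold kern
  refine DifferentiableAt.fun_div (by fun_prop) (by fun_prop) ?_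
  refine mul_ne_zero ht (Finset.prod_ne_zero_iff.2 fun k _ h0 => ?_)
  obtain ⟨j, hj⟩ := one_sub_exp_neg_eq_zero h0
  have ht' : t = 2 * Real.pi * I * j / o k := by rw [← hj]; field_simp [ho k]
  refine h k j ?_ ht'
  rintro rfl
  simp at ht'
  exact ht ht'

/-- Replacing the vanishing factor by its `dslope` writes the kernel as q(t)/(t - s) with q
differentiable at s and q(s) the residue. The difference in question is then a difference quotient
of q. -/
theorem tendsto_kern_sub_pole {o : Fin 3 → ℂ} (h : PairIndep o) (z : ℂ) (k : Fin 3) {j : ℤ}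
    (hj : j ≠ 0) :
    ∃ L, Tendsto (fun t => kern o z t - resTerm o z k j / (t - 2 * Real.pi * I * j / o k))
      (𝓝[≠] (2 * Real.pi * I * j / o k)) (𝓝 L) := by
  have hk := h.ne_zero k
  set s : ℂ := 2 * Real.pi * I * j / o k with hs
  have hso : s * o k = 2 * Real.pi * I * j := by rw [hs]; field_simp
  have hs0 : s ≠ 0 := div_ne_zero (two_pi_I_mul_int_ne_zero hj) hk
  set D : ℂ → ℂ := fun t => 1 - exp (-(t * o k)) with hD
  have hexp : exp (-(s * o k)) = 1 := by
    rw [exp_eq_one_iff]; exact ⟨-j, by rw [hso]; push_cast; ring⟩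
  have hDs : D s = 0 := by simp [hD, hexp]
  have hDd : Differentiable ℂ D := by fun_prop
  have hDer : HasDerivAt D (o k) s := by
    have := (((hasDerivAt_id s).mul_const (o k)).neg.cexp).const_sub 1
    simpa [hexp] using this
  have hdd : DifferentiableAt ℂ (dslope D s) s :=
    ((differentiableOn_dslope univ_mem).2 hDd.differentiableOn).differentiableAt univ_mem
  have hds : dslope D s s = o k := by rw [dslope_same, hDer.deriv]
  set q : ℂ → ℂ := fun t => exp (t * z) /
    (t * dslope D s t * ∏ l ∈ Finset.univ.erase k, (1 - exp (-(t * o l)))) with hq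
  have hprod : ∏ l ∈ Finset.univ.erase k, (1 - exp (-(s * o l))) ≠ 0 :=
    Finset.prod_ne_zero_iff.2 fun l hl => h.pole_ne (Finset.ne_of_mem_erase hl) hj
  have hqd : DifferentiableAt ℂ q s := by
    refine DifferentiableAt.fun_div (by fun_prop) (by fun_prop) ?_
    rw [hds]
    exact mul_ne_zero (mul_ne_zero hs0 hk) hprod
  have hqs : q s = resTerm o z k j := by
    simp only [hq, resTerm, hds, hso]
    rw [← hs]
  refine ⟨_, (hasDerivAt_iff_tendsto_slope.1 hqd.hasDerivAt).congr' ?_⟩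
  filter_upwards [self_mem_nhdsWithin] with t (ht : t ≠ s)
  have hts := sub_ne_zero.2 ht
  have hkq : kern o z t = q t / (t - s) := by
    simp only [kern, hq]
    rw [← Finset.mul_prod_erase _ _ (Finset.mem_univ k), dslope_of_ne _ ht, slope_def_field, hDs,
      sub_zero, div_div]
    congr 1
    simp only [hD]
    field_simp
  rw [hkq, slope_def_field, hqs]
  ring

/-- The jet makes the difference bounded near 0, and Riemann's theorem on removable singularities
gives the limit. -/
theorem tendsto_kern_sub_zero {o : Fin 3 → ℂ} (h : PairIndep o) (z : ℂ) :
    ∃ e₀ e₁ e₂ e₃ : ℂ, e₃ = resNum o z / (o 0 * o 1 * o 2) ∧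
      ∃ L, Tendsto (fun t => kern o z t - (e₀ / t ^ 4 + e₁ / t ^ 3 + e₂ / t ^ 2 + e₃ / t))
        (𝓝[≠] 0) (𝓝 L) := by
  obtain ⟨e₀, e₁, e₂, e₃, he, hJ⟩ := exists_cubicJet_kern o h.ne_zero z
  refine ⟨e₀, e₁, e₂, e₃, he, ?_⟩
  have hne : ∀ᶠ t : ℂ in 𝓝[≠] 0, t ≠ 0 := self_mem_nhdsWithin
  set g : ℂ → ℂ := fun t => kern o z t - (e₀ / t ^ 4 + e₁ / t ^ 3 + e₂ / t ^ 2 + e₃ / t) with hg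
  have hB : g =O[𝓝[≠] 0] fun _ => (1 : ℂ) := by
    have := (isBigO_refl (fun t : ℂ => (t ^ 4)⁻¹) (𝓝[≠] 0)).mul hJ
    refine this.congr' ?_ ?_
    · filter_upwards [hne] with t ht
      simp only [hg]
      field_simp
    · filter_upwards [hne] with t ht
      field_simp
  refine ⟨_, tendsto_limUnder_of_differentiable_on_punctured_nhds_of_bounded_under ?_ ?_⟩
  · have hden : ∀ k, ∀ᶠ t in 𝓝[≠] (0 : ℂ), 1 - exp (-(t * o k)) ≠ 0 := by
      intro k
      have hd : HasDerivAt (fun t : ℂ => 1 - exp (-(t * o k))) (o k) 0 := by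
        have := (((hasDerivAt_id (0 : ℂ)).mul_const (o k)).neg.cexp).const_sub 1
        simpa using this
      exact hd.eventually_ne (h.ne_zero k)
    filter_upwards [hne, eventually_all.2 hden] with t ht hd
    refine DifferentiableAt.sub ?_ ?_
    · unfold kern
      refine DifferentiableAt.fun_div (by fun_prop) (by fun_prop) ?_
      exact mul_ne_zero ht (Finset.prod_ne_zero_iff.2 fun k _ => hd k)
    · fun_prop (disch := simp [ht])
  · have := hB.sub (isBigO_const_const (g 0) (one_ne_zero (α := ℂ)) (𝓝[≠] (0 : ℂ)))
    obtain ⟨C, hC⟩ := this.bound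
    exact ⟨C, by simpa using hC⟩

/-- The indices `j` for which the pole `2πij/o k` of `kern o z` lies in the disc of radius `R`. -/
noncomputable def poleIdx (o : Fin 3 → ℂ) (R : ℝ) (k : Fin 3) : Finset ℤ :=
  Finset.Ioo (-⌈R * ‖o k‖ / (2 * Real.pi)⌉) ⌈R * ‖o k‖ / (2 * Real.pi)⌉

theorem mem_poleIdx {o : Fin 3 → ℂ} (ho : ∀ k, o k ≠ 0) {R : ℝ} {k : Fin 3} {j : ℤ} :
    j ∈ poleIdx o R k ↔ ‖2 * Real.pi * I * j / o k‖ < R := by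
  have hk : 0 < ‖o k‖ := norm_pos_iff.2 (ho k)
  have hpi := Real.pi_pos
  have e : ‖2 * Real.pi * I * j / o k‖ = 2 * Real.pi * |(j : ℝ)| / ‖o k‖ := by
    simp [abs_of_pos hpi]
  rw [e, div_lt_iff₀ hk, ← lt_div_iff₀' (by positivity), poleIdx, Finset.mem_Ioo, neg_lt,
    Int.lt_ceil, Int.lt_ceil, abs_lt, neg_lt]
  push_cast
  rfl

theorem circleIntegral_kern {o : Fin 3 → ℂ} (h : PairIndep o) (z : ℂ) {R : ℝ} (hR : 0 < R)
    (hfar : ∀ k, ∀ j : ℤ, ‖2 * Real.pi * I * j / o k‖ ≠ R) :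
    (∮ t in C(0, R), kern o z t) = 2 * Real.pi * I *
      (∑ k, ∑ j ∈ poleIdx o R k, resTerm o z k j + resNum o z / (o 0 * o 1 * o 2)) := by
  classical
  obtain ⟨e₀, e₁, e₂, e₃, he, hz⟩ := tendsto_kern_sub_zero h z
  set J : Finset (Σ _ : Fin 3, ℤ) := Finset.univ.sigma fun k => (poleIdx o R k).erase 0 with hJ
  have hJm : ∀ q ∈ J, q.2 ≠ 0 ∧ ‖2 * Real.pi * I * q.2 / o q.1‖ < R := by
    intro q hq
    simp only [hJ, Finset.mem_sigma, Finset.mem_erase, mem_poleIdx h.ne_zero] at hq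
    exact hq.2
  -- The index `none` stands for the pole at the origin.
  have key := circleIntegral_eq_sum_of_tendsto J.insertNone
    (fun q => q.elim 0 fun q => 2 * Real.pi * I * q.2 / o q.1) (kern o z)
    (fun q t => q.elim (e₀ / t ^ 4 + e₁ / t ^ 3 + e₂ / t ^ 2 + e₃ / t)
      fun q => resTerm o z q.1 q.2 / (t - 2 * Real.pi * I * q.2 / o q.1)) hR ?_ ?_ ?_ ?_ ?_
  · rw [key, Finset.sum_insertNone]
    simp only [Option.elim]
    have h0 : (∮ t in C(0, R), (e₀ / t ^ 4 + e₁ / t ^ 3 + e₂ / t ^ 2 + e₃ / t)) =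
        2 * Real.pi * I * e₃ := by
      have hci : ∀ (e : ℂ) (n : ℕ), CircleIntegrable (fun t => e / t ^ n) 0 R := by
        intro e n
        refine ContinuousOn.circleIntegrable hR.le fun t ht => ?_
        have ht0 : t ≠ 0 := by
          rintro rfl
          simp at ht
          exact hR.ne ht
        have : ContinuousAt (fun t => e / t ^ n) t := by fun_prop (disch := simp [ht0])
        exact this.continuousWithinAt
      have hint : ∀ (e : ℂ) (n : ℕ), n ≠ 1 → (∮ t in C(0, R), e / t ^ n) = 0 := by
        intro e n hn
        have := circleIntegral.integral_sub_zpow_of_ne (n := -(n : ℤ)) (by omega) 0 0 R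
        simp only [sub_zero, zpow_neg, zpow_natCast] at this
        simp only [div_eq_mul_inv]
        rw [circleIntegral.integral_const_mul, this, mul_zero]
      have hint1 : (∮ t in C(0, R), e₃ / t) = 2 * Real.pi * I * e₃ := by
        have := circleIntegral.integral_sub_center_inv 0 hR.ne'
        simp only [sub_zero] at this
        simp only [div_eq_mul_inv]
        rw [circleIntegral.integral_const_mul, this, mul_comm]
      have h1 : CircleIntegrable (fun t => e₃ / t) 0 R := by simpa using hci e₃ 1
      rw [circleIntegral.integral_add (((hci _ _).fun_add (hci _ _)).fun_add (hci _ _)) h1,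
        circleIntegral.integral_add ((hci _ _).fun_add (hci _ _)) (hci _ _),
        circleIntegral.integral_add (hci _ _) (hci _ _), hint _ _ (by norm_num),
        hint _ _ (by norm_num), hint _ _ (by norm_num), hint1]
      ring
    have h1 : ∀ q ∈ J, (∮ t in C(0, R), resTerm o z q.1 q.2 / (t - 2 * Real.pi * I * q.2 / o q.1)) =
        2 * Real.pi * I * resTerm o z q.1 q.2 := by
      intro q hq
      simp only [div_eq_mul_inv (resTerm o z q.1 q.2)]
      rw [circleIntegral.integral_const_mul, circleIntegral.integral_sub_inv_of_mem_ball, mul_comm]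
      simpa using (hJm q hq).2
    rw [h0, Finset.sum_congr rfl h1, ← Finset.mul_sum, he, hJ, Finset.sum_sigma, mul_add, add_comm]
    congr 2
    refine Finset.sum_congr rfl fun k _ => ?_
    -- The index 0 is harmless: `resTerm` has denominator zero there, so its value is 0.
    refine Finset.sum_subset (Finset.erase_subset _ _) fun j hj hj' => ?_
    have : j = 0 := by
      by_contra h0
      exact hj' (Finset.mem_erase.2 ⟨h0, hj⟩)
    simp [resTerm, this]
  · rintro (_ | q) hq
    · simpa using hR
    · simpa using (hJm q (by simpa using hq)).2
  · rintro (_ | q) hq (_ | q') hq' hqq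
    · rfl
    · exact absurd hqq.symm (div_ne_zero (two_pi_I_mul_int_ne_zero
        (hJm q' (by simpa using hq')).1) (h.ne_zero _))
    · exact absurd hqq (div_ne_zero (two_pi_I_mul_int_ne_zero
        (hJm q (by simpa using hq)).1) (h.ne_zero _))
    · obtain ⟨h1, h2⟩ := h.pole_injective (hJm q' (by simpa using hq')).1 hqq
      congr 1
      exact Sigma.ext h1 (heq_of_eq h2)
  · intro t ht hne
    refine differentiableAt_kern h.ne_zero z (hne none (by simp)) fun k j hj htj => ?_
    refine hne (some ⟨k, j⟩) ?_ htj
    simp only [Finset.some_mem_insertNone, hJ, Finset.mem_sigma, Finset.mem_univ, true_and,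
      Finset.mem_erase]
    refine ⟨hj, (mem_poleIdx h.ne_zero).2 (lt_of_le_of_ne ?_ (hfar k j))⟩
    rw [← htj]
    simpa using ht
  · rintro (_ | q) hq t ht
    · have ht : t ≠ 0 := ht
      simp only [Option.elim]
      fun_prop (disch := simp [ht])
    · have ht : t - 2 * Real.pi * I * q.2 / o q.1 ≠ 0 := sub_ne_zero.2 ht
      simp only [Option.elim]
      fun_prop (disch := exact ht)
  · rintro (_ | q) hq
    · exact hz
    · exact tendsto_kern_sub_pole h z q.1 (hJm q (by simpa using hq)).1

end

/-! ### Decay on large circles and vanishing of the sum of residues -/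

section

open Filter Topology Asymptotics Complex

/-- Re(tp) and Re(tq) are independent real functionals of t; solving for t gives the identity `key`.
-/
theorem norm_le_of_pairIndep {p q : ℂ} (h : (p * (starRingEnd ℂ) q).im ≠ 0) :
    ∃ m > 0, ∀ t : ℂ, m * ‖t‖ ≤ |(t * p).re| + |(t * q).re| := by
  have hp : p ≠ 0 := by rintro rfl; simp at h
  have hp' : 0 < ‖p‖ := norm_pos_iff.2 hp
  have hd : 0 < |(p * (starRingEnd ℂ) q).im| := abs_pos.2 h
  refine ⟨|(p * (starRingEnd ℂ) q).im| / (‖p‖ + ‖q‖), by positivity, fun t => ?_⟩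
  have key : ((p * (starRingEnd ℂ) q).im : ℂ) * (I * t) =
      ((t * p).re : ℂ) * (starRingEnd ℂ) q - ((t * q).re : ℂ) * (starRingEnd ℂ) p := by
    apply Complex.ext <;> simp <;> ring
  have h1 := congrArg norm key
  rw [norm_mul, norm_mul, norm_I, one_mul, norm_real, Real.norm_eq_abs] at h1
  have h2 := norm_sub_le (((t * p).re : ℂ) * (starRingEnd ℂ) q)
    (((t * q).re : ℂ) * (starRingEnd ℂ) p)
  rw [← h1, norm_mul, norm_mul, norm_real, norm_real, RCLike.norm_conj, RCLike.norm_conj,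
    Real.norm_eq_abs, Real.norm_eq_abs] at h2
  rw [div_mul_eq_mul_div, div_le_iff₀ (by positivity)]
  nlinarith [abs_nonneg (t * p).re, abs_nonneg (t * q).re, norm_nonneg p, norm_nonneg q]

/-- For this z the numerator distributes over the denominator: the kernel is 1/t times a product of
factors exp(-s u)/(1 - exp(-u)), u = t o_k, each decaying in |Re u|. Two independent periods already
control |t|. -/
theorem exists_kern_bound {o : Fin 3 → ℂ} (h : PairIndep o) {s : Fin 3 → ℝ}
    (hs : ∀ k, s k ∈ Set.Ioo (0 : ℝ) 1) {ε : ℝ} (hε : 0 < ε) :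
    ∃ C > 0, ∃ c > 0, ∀ t : ℂ, (∀ k, ∀ j : ℤ, ε ≤ |‖t‖ - j * (2 * Real.pi / ‖o k‖)|) →
      ‖kern o (-∑ k, s k * o k) t‖ ≤ C * Real.exp (-(c * ‖t‖)) / ‖t‖ := by
  have hpos : ∀ k, 0 < ‖o k‖ := fun k => norm_pos_iff.2 (h.ne_zero k)
  choose C hC c hc hb using fun k => exists_upper_bound_exp_div (hs k).1 (hs k).2
    (mul_pos hε (hpos k))
  obtain ⟨m, hm, hmb⟩ := norm_le_of_pairIndep (h 0 1 (by decide))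
  refine ⟨∏ k, C k, Finset.prod_pos fun k _ => hC k, min (c 0) (c 1) * m,
    mul_pos (lt_min (hc 0) (hc 1)) hm, fun t ht => ?_⟩
  have hd : ∀ k, ∀ j : ℤ, ε * ‖o k‖ ≤ ‖t * o k - j * (2 * Real.pi * I)‖ := by
    intro k j
    have h1 := abs_norm_sub_norm_le (t * o k) (j * (2 * Real.pi * I))
    refine le_trans ?_ h1
    have h2 : ‖t * o k‖ - ‖(j : ℂ) * (2 * Real.pi * I)‖ =
        (‖t‖ - (|j| : ℤ) * (2 * Real.pi / ‖o k‖)) * ‖o k‖ := by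
      have := (hpos k).ne'
      simp [abs_of_pos Real.pi_pos]
      field_simp
    rw [h2, abs_mul, abs_of_pos (hpos k)]
    exact mul_le_mul_of_nonneg_right (ht k |j|) (hpos k).le
  have hk : kern o (-∑ k, s k * o k) t =
      (∏ k, exp (-(s k * (t * o k))) / (1 - exp (-(t * o k)))) / t := by
    rw [Finset.prod_div_distrib, ← exp_sum, kern, div_div, mul_comm _ t]
    congr 2
    rw [mul_neg, Finset.mul_sum, ← Finset.sum_neg_distrib]
    exact Finset.sum_congr rfl fun k _ => by ring
  rw [hk, norm_div, norm_prod]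
  gcongr
  calc _ ≤ ∏ k, C k * Real.exp (-(c k * |(t * o k).re|)) :=
        Finset.prod_le_prod (fun _ _ => norm_nonneg _) fun k _ => hb k _ (hd k)
    _ = (∏ k, C k) * Real.exp (∑ k, -(c k * |(t * o k).re|)) := by
        rw [Finset.prod_mul_distrib, Real.exp_sum]
    _ ≤ _ := by
        refine mul_le_mul_of_nonneg_left (Real.exp_le_exp.2 ?_)
          (Finset.prod_nonneg fun k _ => (hC k).le)
        rw [Fin.sum_univ_three]
        have h0 := mul_le_mul_of_nonneg_right (min_le_left (c 0) (c 1)) (abs_nonneg (t * o 0).re)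
        have h1 := mul_le_mul_of_nonneg_right (min_le_right (c 0) (c 1)) (abs_nonneg (t * o 1).re)
        have h2 := mul_nonneg (hc 2).le (abs_nonneg (t * o 2).re)
        have h3 := mul_le_mul_of_nonneg_left (hmb t) (lt_min (hc 0) (hc 1)).le
        linarith

/-- The sum of all residues of `kern o z` vanishes if `z` is minus a combination of the periods
with coefficients in the open unit interval. -/
theorem sum_tsum_resTerm {o : Fin 3 → ℂ} (h : PairIndep o) {s : Fin 3 → ℝ}
    (hs : ∀ k, s k ∈ Set.Ioo (0 : ℝ) 1) {z : ℂ} (hz : z = -∑ k, s k * o k)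
    (hsum : ∀ k, Summable (resTerm o z k)) :
    ∑ k, ∑' j, resTerm o z k j = -(resNum o z / (o 0 * o 1 * o 2)) := by
  have hpos : ∀ k, 0 < ‖o k‖ := fun k => norm_pos_iff.2 (h.ne_zero k)
  obtain ⟨ε, hε, hrad⟩ := exists_radius_far (fun k => 2 * Real.pi / ‖o k‖)
    fun k => div_pos (by positivity) (hpos k)
  choose R hR hfar using fun n : ℕ => hrad (n + 1)
  have hR0 : ∀ n, 0 < R n := fun n => lt_of_lt_of_le (by positivity) (hR n)
  have hRt : Tendsto R atTop atTop := tendsto_atTop_mono hR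
    (tendsto_atTop_add_const_right _ _ tendsto_natCast_atTop_atTop)
  obtain ⟨C, hC, c, hc, hb⟩ := exists_kern_bound h hs hε
  have hne : ∀ n k, ∀ j : ℤ, ‖2 * Real.pi * I * j / o k‖ ≠ R n := by
    intro n k j hj
    have h1 := hfar n k |j|
    have h2 : ((|j| : ℤ) : ℝ) * (2 * Real.pi / ‖o k‖) = R n := by
      rw [← hj]
      simp [abs_of_pos Real.pi_pos]
      ring
    rw [h2, sub_self, abs_zero] at h1
    linarith
  have hint : Tendsto (fun n => ∮ t in C(0, R n), kern o z t) atTop (𝓝 0) := by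
    have h1 : Tendsto (fun n => 2 * Real.pi * C * Real.exp (-(c * R n))) atTop (𝓝 0) := by
      have h2 : Tendsto (fun n => Real.exp (-(c * R n))) atTop (𝓝 0) :=
        Real.tendsto_exp_neg_atTop_nhds_zero.comp (hRt.const_mul_atTop hc)
      simpa using h2.const_mul (2 * Real.pi * C)
    refine squeeze_zero_norm (fun n => ?_) h1
    have h3 := circleIntegral.norm_integral_le_of_norm_le_const (f := kern o z) (c := 0) (hR0 n).le
      (C := C * Real.exp (-(c * R n)) / R n) fun t ht => by
        have htR : ‖t‖ = R n := by simpa using ht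
        have := hb t (by rw [htR]; exact hfar n)
        rwa [← hz, htR] at this
    refine h3.trans_eq ?_
    -- The length 2πR of the circle cancels the factor 1/R in the bound.
    have := (hR0 n).ne'
    field_simp
  have hlim : Tendsto (fun n => 2 * Real.pi * I * (∑ k, ∑ j ∈ poleIdx o (R n) k, resTerm o z k j +
      resNum o z / (o 0 * o 1 * o 2))) atTop (𝓝 (2 * Real.pi * I *
        (∑ k, ∑' j, resTerm o z k j + resNum o z / (o 0 * o 1 * o 2)))) := by
    refine Tendsto.const_mul _ (Tendsto.add_const _ (tendsto_finsetSum _ fun k _ => ?_))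
    refine (hsum k).hasSum.comp (tendsto_atTop.2 fun S => ?_)
    have : ∀ᶠ n in atTop, ∀ j ∈ S, j ∈ poleIdx o (R n) k := by
      rw [Filter.eventually_all_finset]
      intro j _
      filter_upwards [hRt.eventually_gt_atTop ‖2 * Real.pi * I * j / o k‖] with n hn
      exact (mem_poleIdx h.ne_zero).2 hn
    exact this
  have h0 := tendsto_nhds_unique hlim
    (hint.congr fun n => circleIntegral_kern h z (hR0 n) (hne n))
  have := (mul_eq_zero.1 h0).resolve_left two_pi_I_ne_zero
  linear_combination this

end

/-! ### Infinite products as exponentials of sums of residues -/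

section

open Filter Topology Asymptotics Complex

/-- The infinite product `∏ (1 - y Q ^ m R ^ n)` as an exponential. -/
theorem exists_hasProd_one_sub_mul_pow {y Q R : ℂ} (hy : ‖y‖ < 1) (hQ : ‖Q‖ < 1) (hR : ‖R‖ < 1) :
    ∃ S, HasSum (fun j : ℕ => y ^ (j + 1) / ((j + 1) * ((1 - Q ^ (j + 1)) * (1 - R ^ (j + 1))))) S ∧
      HasProd (fun p : ℕ × ℕ => 1 - y * Q ^ p.1 * R ^ p.2) (exp (-S)) := by
  set F : (ℕ × ℕ) × ℕ → ℂ := fun q => (y * Q ^ q.1.1 * R ^ q.1.2) ^ (q.2 + 1) / ((q.2 : ℂ) + 1)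
    with hF
  have hsQ := summable_geometric_of_lt_one (norm_nonneg _) hQ
  have hsR := summable_geometric_of_lt_one (norm_nonneg _) hR
  have hsy := summable_geometric_of_lt_one (norm_nonneg _) hy
  have hsum : Summable F := by
    have h1 := (hsQ.mul_of_nonneg hsR (fun _ => by positivity) (fun _ => by positivity)).mul_of_nonneg
      hsy (fun _ => by simp only [Pi.zero_apply]; positivity) (fun _ => by positivity)
    refine Summable.of_norm_bounded h1 fun q => ?_
    obtain ⟨⟨m, n⟩, j⟩ := q
    simp only [hF, norm_div, norm_pow, norm_mul]
    have h2 : (1 : ℝ) ≤ ‖(j : ℂ) + 1‖ := by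
      rw [← Nat.cast_succ, Complex.norm_natCast]
      exact_mod_cast Nat.succ_le_succ (Nat.zero_le j)
    refine (div_le_self (by positivity) h2).trans ?_
    rw [mul_pow, mul_pow]
    have h3 : (‖Q‖ ^ m) ^ (j + 1) ≤ ‖Q‖ ^ m :=
      pow_le_of_le_one (by positivity) (pow_le_one₀ (norm_nonneg _) hQ.le) (by omega)
    have h4 : (‖R‖ ^ n) ^ (j + 1) ≤ ‖R‖ ^ n :=
      pow_le_of_le_one (by positivity) (pow_le_one₀ (norm_nonneg _) hR.le) (by omega)
    have h5 : ‖y‖ ^ (j + 1) ≤ ‖y‖ ^ j :=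
      pow_le_pow_of_le_one (norm_nonneg _) hy.le (by omega)
    calc _ ≤ ‖y‖ ^ j * ‖Q‖ ^ m * ‖R‖ ^ n := by gcongr
      _ = _ := by ring
  have hlt : ∀ p : ℕ × ℕ, ‖y * Q ^ p.1 * R ^ p.2‖ < 1 := by
    intro p
    rw [norm_mul, norm_mul, norm_pow, norm_pow]
    have h1 := pow_le_one₀ (n := p.1) (norm_nonneg _) hQ.le
    have h2 := pow_le_one₀ (n := p.2) (norm_nonneg _) hR.le
    calc _ ≤ ‖y‖ * 1 * 1 := by gcongr
      _ < 1 := by simpa using hy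
  refine ⟨∑' q, F q, ?_, ?_⟩
  · have h1 := (Equiv.prodComm ℕ (ℕ × ℕ)).hasSum_iff.2 hsum.hasSum
    refine h1.prod_fiberwise fun j => ?_
    have hQj : ‖Q ^ (j + 1)‖ < 1 := by
      rw [norm_pow]; exact pow_lt_one₀ (norm_nonneg _) hQ (by omega)
    have hRj : ‖R ^ (j + 1)‖ < 1 := by
      rw [norm_pow]; exact pow_lt_one₀ (norm_nonneg _) hR (by omega)
    have h2 := (hasSum_geometric_of_norm_lt_one hQj).mul (hasSum_geometric_of_norm_lt_one hRj)
      (summable_mul_of_summable_norm (summable_norm_geometric_of_norm_lt_one hQj)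
        (summable_norm_geometric_of_norm_lt_one hRj))
    have h3 := h2.mul_left (y ^ (j + 1) / ((j : ℂ) + 1))
    have e : y ^ (j + 1) / ((j : ℂ) + 1) * ((1 - Q ^ (j + 1))⁻¹ * (1 - R ^ (j + 1))⁻¹) =
        y ^ (j + 1) / ((j + 1) * ((1 - Q ^ (j + 1)) * (1 - R ^ (j + 1)))) := by
      rw [← mul_inv, ← div_eq_mul_inv, div_div]
    rw [e] at h3
    refine h3.congr_fun fun p => ?_
    simp only [hF, Function.comp, Equiv.prodComm_apply, Prod.swap]
    rw [mul_pow, mul_pow, ← pow_mul, ← pow_mul, ← pow_mul, ← pow_mul, mul_comm p.1, mul_comm p.2]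
    ring
  · refine Complex.hasProd_of_hasSum_log (fun p h0 => ?_) ?_
    · have h1 : y * Q ^ p.1 * R ^ p.2 = 1 := (sub_eq_zero.1 h0).symm
      have := hlt p
      rw [h1, norm_one] at this
      exact lt_irrefl _ this
    · rw [← neg_neg (fun p : ℕ × ℕ => log (1 - y * Q ^ p.1 * R ^ p.2))]
      refine HasSum.neg (hsum.hasSum.prod_fiberwise fun p => ?_)
      have h1 := (hasSum_nat_add_iff' 1).2 (Complex.hasSum_taylorSeries_neg_log (hlt p))
      simpa [hF] using h1

theorem norm_exp_two_pi_I_mul_lt_one {u : ℂ} (h : 0 < u.im) :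
    ‖exp (2 * Real.pi * I * u)‖ < 1 := by
  rw [norm_exp, Real.exp_lt_one_iff]
  simp
  positivity

/-- With E(u) = exp(2πi u/o_k), 2πi times the residue is E(jz) / (j (1 - E(-j o_a)) (1 - E(-j
o_b))). Of E(-o_a) and E(o_b), both less than 1 in modulus, only the second occurs inverted when j >
0, and only the first when j < 0. Clearing that inverse turns j > 0 into the logarithm of the first
product and j < 0 into minus the logarithm of the second. -/
theorem exists_hasProd_resTerm (o : Fin 3 → ℂ) (z : ℂ) (k a b : Fin 3)
    (hab : a ≠ b) (hk : Finset.univ.erase k = {a, b})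
    (ha : (o a / o k).im < 0) (hb : 0 < (o b / o k).im)
    (hz : 0 < ((z + o b) / o k).im) (hz' : 0 < ((-z - o a) / o k).im) :
    ∃ S T, HasProd (fun p : ℕ × ℕ =>
        1 - exp (2 * Real.pi * I * ((z - p.1 * o a + (p.2 + 1) * o b) / o k))) (exp (-S)) ∧
      HasProd (fun p : ℕ × ℕ =>
        1 - exp (2 * Real.pi * I * ((-z + p.1 * o b - (p.2 + 1) * o a) / o k))) (exp (-T)) ∧
      HasSum (fun j : ℤ => 2 * Real.pi * I * resTerm o z k j) (T - S) := by
  obtain ⟨E, hE⟩ : ∃ E : ℂ → ℂ, ∀ u, E u = exp (2 * Real.pi * I * (u / o k)) := ⟨_, fun _ => rfl⟩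
  have hadd : ∀ u v, E (u + v) = E u * E v := fun u v => by
    simp only [hE, ← exp_add]; congr 1; ring
  have hpow : ∀ (u : ℂ) (n : ℕ), E (n * u) = E u ^ n := fun u n => by
    simp only [hE, ← exp_nat_mul]; congr 1; ring
  have hne : ∀ u, E u ≠ 0 := fun u => by rw [hE]; exact exp_ne_zero _
  have hneg : ∀ u, E (-u) = (E u)⁻¹ := fun u => by
    simp only [hE, ← exp_neg]; congr 1; ring
  have hlt : ∀ u, 0 < (u / o k).im → ‖E u‖ < 1 := fun u hu => by
    rw [hE]; exact norm_exp_two_pi_I_mul_lt_one hu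
  have hQ : ‖E (-o a)‖ < 1 := hlt _ (by rw [neg_div, neg_im]; linarith)
  have hR : ‖E (o b)‖ < 1 := hlt _ hb
  obtain ⟨S, hS, hPS⟩ := exists_hasProd_one_sub_mul_pow (hlt _ hz) hQ hR
  obtain ⟨T, hT, hPT⟩ := exists_hasProd_one_sub_mul_pow (hlt _ hz') hR hQ
  have hone : ∀ u, ‖E u‖ < 1 → ∀ n : ℕ, 1 - E u ^ (n + 1) ≠ 0 := by
    intro u hu n h0
    have h1 : ‖E u ^ (n + 1)‖ < 1 := by
      rw [norm_pow]; exact pow_lt_one₀ (norm_nonneg _) hu (by omega)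
    rw [← sub_eq_zero.1 h0, norm_one] at h1
    exact lt_irrefl _ h1
  have hres : ∀ j : ℤ, 2 * Real.pi * I * resTerm o z k j =
      E (j * z) / (j * ((1 - E (-(j * o a))) * (1 - E (-(j * o b))))) := by
    intro j
    have e1 : ∀ u, 2 * Real.pi * I * j / o k * u = 2 * Real.pi * I * (j * u / o k) :=
      fun u => by ring
    have e2 : ∀ u, -(2 * Real.pi * I * (j * u / o k)) = 2 * Real.pi * I * (-(j * u) / o k) :=
      fun u => by ring
    simp only [resTerm, hk, Finset.prod_pair hab, hE, e1, e2]
    rw [mul_assoc (2 * (Real.pi : ℂ) * I) (j : ℂ) _, ← div_div,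
      mul_div_assoc', mul_div_assoc', mul_div_cancel_left₀ _ two_pi_I_ne_zero]
  have halg : ∀ {A B N : ℂ} (Z : ℂ), B ≠ 0 → N ≠ 0 → 1 - A ≠ 0 → 1 - B ≠ 0 →
      Z / (N * ((1 - A) * (1 - B⁻¹))) = -(Z * B / (N * ((1 - A) * (1 - B)))) := by
    intro A B N Z hB hN hA1 hB1
    have h6 : 1 - B⁻¹ = -((1 - B) / B) := by field_simp; ring
    rw [h6]
    field_simp
  have halg' : ∀ {A B N : ℂ} (Z : ℂ), A ≠ 0 → N ≠ 0 → 1 - B ≠ 0 → 1 - A ≠ 0 →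
      Z / (-N * ((1 - A⁻¹) * (1 - B))) = Z * A / (N * ((1 - B) * (1 - A))) := by
    intro A B N Z hA hN hB1 hA1
    have h6 : 1 - A⁻¹ = -((1 - A) / A) := by field_simp; ring
    rw [h6]
    field_simp
  refine ⟨S, T, hPS.congr_fun fun p => ?_, hPT.congr_fun fun p => ?_, ?_⟩
  · rw [← hpow, ← hpow, ← hadd, ← hadd]
    simp only [hE]
    congr 4
    ring
  · rw [← hpow, ← hpow, ← hadd, ← hadd]
    simp only [hE]
    congr 4
    ring
  · have h1 : HasSum (fun n : ℕ => 2 * Real.pi * I * resTerm o z k n) (-S) := by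
      rw [← hasSum_nat_add_iff' 1]
      have e0 : -S - ∑ i ∈ Finset.range 1, 2 * Real.pi * I * resTerm o z k ((i : ℕ) : ℤ) = -S := by
        simp [resTerm]
      rw [e0]
      refine hS.neg.congr_fun fun n => ?_
      rw [hres]
      have e1 : (((n + 1 : ℕ) : ℤ) : ℂ) = ((n + 1 : ℕ) : ℂ) := by push_cast; rfl
      rw [e1, ← mul_neg, ← mul_neg, hpow, hpow, hpow, hadd, mul_pow, hneg (o b), inv_pow]
      have h2 := hone _ hQ n
      have h3 := hone _ hR n
      have h4 : E (o b) ^ (n + 1) ≠ 0 := pow_ne_zero _ (hne _)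
      have h5 : ((n + 1 : ℕ) : ℂ) ≠ 0 := Nat.cast_ne_zero.2 (Nat.succ_ne_zero n)
      rw [← Nat.cast_succ, Nat.succ_eq_add_one]
      exact halg _ h4 h5 h2 h3
    have h2 : HasSum (fun n : ℕ => 2 * Real.pi * I * resTerm o z k (-(n + 1))) T := by
      refine hT.congr_fun fun n => ?_
      rw [hres]
      have e1 : ((-((n : ℤ) + 1) : ℤ) : ℂ) = -((n + 1 : ℕ) : ℂ) := by push_cast; rfl
      have e2 : ∀ u : ℂ, -(-((n + 1 : ℕ) : ℂ) * u) = ((n + 1 : ℕ) : ℂ) * u := fun u => by ring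
      rw [e1, e2, e2, neg_mul, ← mul_neg, hpow, hpow, hpow, sub_eq_add_neg (-z), hadd, mul_pow]
      have h7 : E (o a) = (E (-o a))⁻¹ := by rw [← hneg, neg_neg]
      have h2 := hone _ hQ n
      have h3 := hone _ hR n
      have h4 : E (-o a) ^ (n + 1) ≠ 0 := pow_ne_zero _ (hne _)
      have h5 : ((n + 1 : ℕ) : ℂ) ≠ 0 := Nat.cast_ne_zero.2 (Nat.succ_ne_zero n)
      rw [← Nat.cast_succ, Nat.succ_eq_add_one, h7, inv_pow]
      exact (halg' _ h4 h5 h3 h2)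
    have := HasSum.of_nat_of_neg_add_one
      (f := fun j : ℤ => 2 * Real.pi * I * resTerm o z k j) h1 h2
    rwa [neg_add_eq_sub] at this

end

/-! ### Primitive vectors, direction vectors and the weight `wt` -/

section

open scoped Matrix

theorem IsPrimitive.exists_dotProduct_eq_one {a : Fin 3 → ℤ} (ha : IsPrimitive a) :
    ∃ y, a ⬝ᵥ y = 1 := by
  obtain ⟨f, hf⟩ := Finset.gcd_eq_sum_mul Finset.univ a
  have hg : Finset.univ.gcd a = 1 ∨ Finset.univ.gcd a = -1 := by
    refine ha _ ⟨fun i => a i / Finset.univ.gcd a, funext fun i => ?_⟩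
    exact (Int.mul_ediv_cancel' (Finset.gcd_dvd (Finset.mem_univ i))).symm
  have hd : a ⬝ᵥ f = Finset.univ.gcd a := by
    rw [hf]; simp only [dotProduct]
  rcases hg with h | h
  · exact ⟨f, hd.trans h⟩
  · exact ⟨-f, by rw [dotProduct_neg, hd, h, neg_neg]⟩

theorem IsPrimitive.ne_zero {a : Fin 3 → ℤ} (ha : IsPrimitive a) : a ≠ 0 := by
  rintro rfl
  obtain ⟨y, hy⟩ := ha.exists_dotProduct_eq_one
  simp at hy

theorem cross_cross_right {R : Type*} [CommRing R] (u a b : Fin 3 → R) :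
    u ⨯₃ (a ⨯₃ b) = (u ⬝ᵥ b) • a - (u ⬝ᵥ a) • b := by
  funext i
  fin_cases i <;> simp [cross_apply, dotProduct, Fin.sum_univ_three] <;> ring

theorem eq_smul_of_cross_eq_zero {a b y : Fin 3 → ℤ} (hy : a ⬝ᵥ y = 1) (h : a ⨯₃ b = 0) :
    b = (y ⬝ᵥ b) • a := by
  have h1 := cross_cross_right y a b
  rw [h, map_zero, dotProduct_comm y a, hy, one_smul] at h1
  exact (sub_eq_zero.1 h1.symm).symm

theorem IsPrimitive.eq_or_eq_neg {a b : Fin 3 → ℤ} (ha : IsPrimitive a) (hb : IsPrimitive b)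
    (h : a ⨯₃ b = 0) : b = a ∨ b = -a := by
  obtain ⟨y, hy⟩ := ha.exists_dotProduct_eq_one
  have h1 := eq_smul_of_cross_eq_zero hy h
  rcases hb _ ⟨a, h1⟩ with h2 | h2
  · left; rw [h1, h2, one_smul]
  · right; rw [h1, h2, neg_smul, one_smul]

/-- Uniqueness of the primitive vector on a ray; `directionVector_eq` identifies direction vectors
by it. -/
theorem IsPrimitive.eq_of_smul_eq_smul {a b : Fin 3 → ℤ} (ha : IsPrimitive a) (hb : IsPrimitive b)
    {s t : ℤ} (hs : 0 < s) (ht : 0 < t) (h : s • a = t • b) : a = b := by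
  have h0 : a ⨯₃ b = 0 := by
    have h1 : s • (a ⨯₃ b) = 0 := by
      rw [← LinearMap.smul_apply, ← map_smul, h, map_smul, LinearMap.smul_apply, cross_self, smul_zero]
    exact (smul_eq_zero.1 h1).resolve_left hs.ne'
  rcases ha.eq_or_eq_neg hb h0 with h2 | h2
  · exact h2.symm
  · exfalso
    rw [h2, smul_neg, ← neg_smul] at h
    obtain ⟨y, hy⟩ := ha.exists_dotProduct_eq_one
    have h3 := congrArg (· ⬝ᵥ y) h
    simp only [smul_dotProduct, hy, smul_eq_mul, mul_one] at h3
    omega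

theorem linearIndependent_of_cross_ne_zero {a b : Fin 3 → ℤ} (h : a ⨯₃ b ≠ 0) :
    LinearIndependent ℤ ![a, b] := by
  rw [LinearIndependent.pair_iff]
  intro s t hst
  constructor
  · have h1 := congrArg (fun u => u ⨯₃ b) hst
    simpa [h, -zsmul_eq_mul] using h1
  · have h1 := congrArg (fun u => a ⨯₃ u) hst
    simpa [h, -zsmul_eq_mul] using h1

theorem directionVector_isPrimitive {a b : Fin 3 → ℤ} (h : a ⨯₃ b ≠ 0) :
    IsPrimitive (directionVector a b) :=
  (directionVector_spec a b (linearIndependent_of_cross_ne_zero h)).1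

theorem exists_cross_eq_smul {a b : Fin 3 → ℤ} (h : a ⨯₃ b ≠ 0) :
    ∃ s : ℤ, 0 < s ∧ a ⨯₃ b = s • directionVector a b := by
  obtain ⟨-, s, hs, hd⟩ := directionVector_spec a b (linearIndependent_of_cross_ne_zero h)
  refine ⟨s, hs, funext fun i => ?_⟩
  have := hd (Pi.single i 1)
  rw [det_eq_cross] at this
  simpa using this

theorem directionVector_eq {a b γ : Fin 3 → ℤ} (h : a ⨯₃ b ≠ 0) (hγ : IsPrimitive γ) {s t : ℤ}
    (hs : 0 < s) (ht : 0 < t) (he : s • (a ⨯₃ b) = t • γ) : directionVector a b = γ := by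
  obtain ⟨r, hr, hd⟩ := exists_cross_eq_smul h
  rw [hd, smul_smul] at he
  exact (directionVector_isPrimitive h).eq_of_smul_eq_smul hγ (mul_pos hs hr) ht he

theorem IsPrimitive.neg {a : Fin 3 → ℤ} (ha : IsPrimitive a) : IsPrimitive (-a) := by
  rintro k ⟨u, hu⟩
  exact ha k ⟨-u, by rw [smul_neg, ← hu, neg_neg]⟩

theorem cross_swap_ne_zero {a b : Fin 3 → ℤ} (h : a ⨯₃ b ≠ 0) : b ⨯₃ a ≠ 0 := by
  rw [← cross_anticomm, neg_ne_zero]; exact h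

theorem directionVector_swap {a b : Fin 3 → ℤ} (h : a ⨯₃ b ≠ 0) :
    directionVector b a = -directionVector a b := by
  obtain ⟨s, hs, hd⟩ := exists_cross_eq_smul h
  refine directionVector_eq (cross_swap_ne_zero h) (directionVector_isPrimitive h).neg one_pos hs ?_
  rw [one_smul, ← cross_anticomm, hd, smul_neg]

theorem directionVector_dot_left {a b : Fin 3 → ℤ} (h : a ⨯₃ b ≠ 0) :
    directionVector a b ⬝ᵥ a = 0 := by
  obtain ⟨s, hs, hd⟩ := exists_cross_eq_smul h
  have h1 := dot_self_cross a b
  rw [hd, dotProduct_smul, smul_eq_mul, dotProduct_comm] at h1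
  exact (mul_eq_zero.1 h1).resolve_left hs.ne'

theorem directionVector_dot_right {a b : Fin 3 → ℤ} (h : a ⨯₃ b ≠ 0) :
    directionVector a b ⬝ᵥ b = 0 := by
  obtain ⟨s, hs, hd⟩ := exists_cross_eq_smul h
  have h1 := dot_cross_self a b
  rw [hd, dotProduct_smul, smul_eq_mul, dotProduct_comm] at h1
  exact (mul_eq_zero.1 h1).resolve_left hs.ne'

/-- The triple product expansion of δ × (a × b) vanishes, so δ is parallel to the direction vector,
and primitivity makes the factor integral. -/
theorem mem_zmultiples_directionVector {a b δ : Fin 3 → ℤ} (h : a ⨯₃ b ≠ 0) (ha : δ ⬝ᵥ a = 0)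
    (hb : δ ⬝ᵥ b = 0) : δ ∈ AddSubgroup.zmultiples (directionVector a b) := by
  obtain ⟨s, hs, hd⟩ := exists_cross_eq_smul h
  obtain ⟨y, hy⟩ := (directionVector_isPrimitive h).exists_dotProduct_eq_one
  have h1 := cross_cross_right δ a b
  rw [ha, hb, zero_smul, zero_smul, sub_zero, hd, map_smul] at h1
  have h2 := (smul_eq_zero.1 h1).resolve_left hs.ne'
  rw [← cross_anticomm, neg_eq_zero] at h2
  exact AddSubgroup.mem_zmultiples_iff.2 ⟨_, (eq_smul_of_cross_eq_zero hy h2).symm⟩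

/-- The pairing of `a` with the vector product of the imaginary and real parts of `x`; it is
positive on `U_a^+`. -/
noncomputable def wt (a : Fin 3 → ℤ) (x : Fin 3 → ℂ) : ℝ :=
  (fun i => (a i : ℝ)) ⬝ᵥ ((fun i => (x i).im) ⨯₃ (fun i => (x i).re))

theorem im_formEval_mul_conj (δ γ : Fin 3 → ℤ) (x : Fin 3 → ℂ) :
    (formEval δ x * (starRingEnd ℂ) (formEval γ x)).im = wt (δ ⨯₃ γ) x := by
  simp [formEval, wt, cross_apply, dotProduct, Fin.sum_univ_three]
  ring

/-- Both α and β are orthogonal to a, so α × β is a multiple of a, a positive one by the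
orientation. Since Im(α(x) conj β(x)) is the pairing of α × β with Im x × Re x, it has the sign of
`wt a x`. -/
theorem wt_pos {a : Fin 3 → ℤ} (ha : a ≠ 0) {x : Fin 3 → ℂ} (hx : x ∈ UPlus a) : 0 < wt a x := by
  obtain ⟨α, β, ⟨hα, hβ, -, ho⟩, him⟩ := hx
  set A : Fin 3 → ℚ := fun i => (a i : ℚ) with hA
  have hAA : 0 < A ⬝ᵥ A := by
    have h1 : A ⬝ᵥ A ≠ 0 := fun h0 => ha (by
      funext i
      have := congrFun (dotProduct_self_eq_zero.1 h0) i
      simpa [hA] using this)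
    refine lt_of_le_of_ne ?_ h1.symm
    simp only [dotProduct]
    exact Finset.sum_nonneg fun i _ => mul_self_nonneg _
  have hdet := ho A hAA
  have h1 : (Matrix.of ![α, β, A]).det = (α ⨯₃ β) ⬝ᵥ A := by
    rw [Matrix.det_fin_three]
    simp [cross_apply, dotProduct, Fin.sum_univ_three]
    ring
  rw [h1] at hdet
  have h2 : (A ⬝ᵥ A) • (α ⨯₃ β) = ((α ⨯₃ β) ⬝ᵥ A) • A := by
    have h3 := cross_cross_right A α β
    rw [dotProduct_comm A α, dotProduct_comm A β, hα, hβ, zero_smul, zero_smul, sub_zero] at h3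
    have h4 := cross_cross_right A A (α ⨯₃ β)
    rw [h3, map_zero, dotProduct_comm A (α ⨯₃ β)] at h4
    exact (sub_eq_zero.1 h4.symm).symm
  have h5 : (formEval α x * (starRingEnd ℂ) (formEval β x)).im =
      (fun i => ((α ⨯₃ β) i : ℝ)) ⬝ᵥ ((fun i => (x i).im) ⨯₃ (fun i => (x i).re)) := by
    simp [formEval, cross_apply, dotProduct, Fin.sum_univ_three]
    ring
  have h6 : ((A ⬝ᵥ A : ℚ) : ℝ) * (formEval α x * (starRingEnd ℂ) (formEval β x)).im =
      (((α ⨯₃ β) ⬝ᵥ A : ℚ) : ℝ) * wt a x := by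
    rw [h5, wt, ← smul_eq_mul, ← smul_eq_mul, ← smul_dotProduct, ← smul_dotProduct]
    congr 1
    funext i
    have h7 := congrFun h2 i
    simp only [Pi.smul_apply, smul_eq_mul, hA] at h7 ⊢
    have h8 := congrArg (fun r : ℚ => (r : ℝ)) h7
    push_cast at h8
    exact h8
  have h9 : 0 < (((α ⨯₃ β) ⬝ᵥ A : ℚ) : ℝ) * wt a x := by
    rw [← h6]
    exact mul_pos (by exact_mod_cast hAA) him
  exact (mul_pos_iff_of_pos_left (by exact_mod_cast hdet)).1 h9

theorem wt_sub (a b : Fin 3 → ℤ) (x : Fin 3 → ℂ) : wt (a - b) x = wt a x - wt b x := by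
  simp [wt, dotProduct, Fin.sum_univ_three]; ring

theorem wt_smul (s : ℤ) (a : Fin 3 → ℤ) (x : Fin 3 → ℂ) : wt (s • a) x = s * wt a x := by
  simp [wt, dotProduct, Fin.sum_univ_three]; ring

theorem im_formEval_mul_conj_directionVector {a b : Fin 3 → ℤ} {s : ℤ}
    (hd : a ⨯₃ b = s • directionVector a b) (δ : Fin 3 → ℤ) (x : Fin 3 → ℂ) :
    s * (formEval δ x * (starRingEnd ℂ) (formEval (directionVector a b) x)).im =
      (δ ⬝ᵥ b : ℤ) * wt a x - (δ ⬝ᵥ a : ℤ) * wt b x := by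
  rw [im_formEval_mul_conj, ← wt_smul, ← map_smul, ← hd, cross_cross_right, wt_sub, wt_smul,
    wt_smul]

/-- Tested on δ = b × (a × b), which kills b and takes the value |a × b|² at a. -/
theorem formEval_directionVector_ne_zero {a b : Fin 3 → ℤ} (h : a ⨯₃ b ≠ 0) {x : Fin 3 → ℂ}
    (hx : 0 < wt b x) : formEval (directionVector a b) x ≠ 0 := by
  intro h0
  obtain ⟨s, hs, hd⟩ := exists_cross_eq_smul h
  have h1 := im_formEval_mul_conj_directionVector hd (b ⨯₃ (a ⨯₃ b)) x
  have h2 : (b ⨯₃ (a ⨯₃ b)) ⬝ᵥ b = 0 := by rw [dotProduct_comm]; exact dot_self_cross _ _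
  have h3 : (b ⨯₃ (a ⨯₃ b)) ⬝ᵥ a = (a ⨯₃ b) ⬝ᵥ (a ⨯₃ b) := by
    simp [cross_apply, dotProduct, Fin.sum_univ_three]; ring
  rw [h0, h2, h3] at h1
  simp [hx.ne', h] at h1

/-- The imaginary part of `δ(x) / γ(x)`. -/
theorem exists_im_formEval_div {a b : Fin 3 → ℤ} (h : a ⨯₃ b ≠ 0) {x : Fin 3 → ℂ}
    (hb : 0 < wt b x) : ∃ c > 0, ∀ δ : Fin 3 → ℤ,
      (formEval δ x / formEval (directionVector a b) x).im =
        c * wt a x * (δ ⬝ᵥ b : ℤ) - c * wt b x * (δ ⬝ᵥ a : ℤ) := by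
  obtain ⟨s, hs, hd⟩ := exists_cross_eq_smul h
  have h0 := formEval_directionVector_ne_zero h hb
  have hn : 0 < Complex.normSq (formEval (directionVector a b) x) := Complex.normSq_pos.2 h0
  have hs' : (0 : ℝ) < s := by exact_mod_cast hs
  refine ⟨(s * Complex.normSq (formEval (directionVector a b) x))⁻¹, by positivity, fun δ => ?_⟩
  have h1 := im_formEval_mul_conj_directionVector hd δ x
  have h2 : (formEval δ x / formEval (directionVector a b) x).im =
      (formEval δ x * (starRingEnd ℂ) (formEval (directionVector a b) x)).im /
        Complex.normSq (formEval (directionVector a b) x) := by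
    rw [div_eq_mul_inv, Complex.inv_def, ← mul_assoc, Complex.im_mul_ofReal, div_eq_mul_inv]
  rw [h2]
  field_simp
  linarith

theorem formEval_add (a b : Fin 3 → ℤ) (x : Fin 3 → ℂ) :
    formEval (a + b) x = formEval a x + formEval b x := by
  simp [formEval, Fin.sum_univ_three]; ring

theorem formEval_sub (a b : Fin 3 → ℤ) (x : Fin 3 → ℂ) :
    formEval (a - b) x = formEval a x - formEval b x := by
  simp [formEval, Fin.sum_univ_three]; ring

theorem formEval_neg (a : Fin 3 → ℤ) (x : Fin 3 → ℂ) :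
    formEval (-a) x = -formEval a x := by
  simp [formEval]

theorem formEval_zsmul (n : ℤ) (a : Fin 3 → ℤ) (x : Fin 3 → ℂ) :
    formEval (n • a) x = n * formEval a x := by
  simp [formEval, Fin.sum_univ_three]; ring

end

/-! ### Convergence, zeros and holomorphy of the products over a cone -/

section

open Filter Topology Complex
open scoped Matrix

/-- The infinite product over `cone a b / ℤγ` of the factors with sign `ε`. -/
noncomputable def wedgeProd (ε : ℤ) (a b γ : Fin 3 → ℤ) (x : Fin 3 → ℂ) (w : ℂ) : ℂ :=
  ∏' q : orbits (cone a b) γ, factor ε γ w x q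

/-- The form `γ` spans the forms vanishing at `a` and `b`, and `ε δ(x) / γ(x)` has an imaginary part
which makes the product `wedgeProd ε a b γ x` converge. -/
structure Admissible (ε : ℤ) (a b γ : Fin 3 → ℤ) (x : Fin 3 → ℂ) : Prop where
  sq_eq_one : ε * ε = 1
  dot_left : γ ⬝ᵥ a = 0
  dot_right : γ ⬝ᵥ b = 0
  mem_zmultiples : ∀ δ, δ ⬝ᵥ a = 0 → δ ⬝ᵥ b = 0 → δ ∈ AddSubgroup.zmultiples γ
  ne_zero : formEval γ x ≠ 0
  exists_im : ∃ A > 0, ∃ B > 0, ∀ δ : Fin 3 → ℤ, ε * (formEval δ x / formEval γ x).im =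
    A * (δ ⬝ᵥ a : ℤ) - B * (δ ⬝ᵥ b : ℤ)

theorem admissible_num {a b : Fin 3 → ℤ} (h : a ⨯₃ b ≠ 0) {x : Fin 3 → ℂ} (ha : 0 < wt a x)
    (hb : 0 < wt b x) : Admissible (-1) a b (directionVector a b) x where
  sq_eq_one := by norm_num
  dot_left := directionVector_dot_left h
  dot_right := directionVector_dot_right h
  mem_zmultiples _ := mem_zmultiples_directionVector h
  ne_zero := formEval_directionVector_ne_zero h hb
  exists_im := by
    obtain ⟨c, hc, hd⟩ := exists_im_formEval_div h hb
    refine ⟨c * wt b x, by positivity, c * wt a x, by positivity, fun δ => ?_⟩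
    rw [hd]
    push_cast
    ring

theorem admissible_den {a b : Fin 3 → ℤ} (h : a ⨯₃ b ≠ 0) {x : Fin 3 → ℂ} (ha : 0 < wt a x)
    (hb : 0 < wt b x) : Admissible 1 b a (directionVector a b) x where
  sq_eq_one := by norm_num
  dot_left := directionVector_dot_right h
  dot_right := directionVector_dot_left h
  mem_zmultiples _ h1 h2 := mem_zmultiples_directionVector h h2 h1
  ne_zero := formEval_directionVector_ne_zero h hb
  exists_im := by
    obtain ⟨c, hc, hd⟩ := exists_im_formEval_div h hb
    refine ⟨c * wt a x, by positivity, c * wt b x, by positivity, fun δ => ?_⟩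
    rw [hd]
    push_cast
    ring

variable {ε : ℤ} {a b γ : Fin 3 → ℤ} {x : Fin 3 → ℂ}

theorem factor_mk (ε : ℤ) (γ δ : Fin 3 → ℤ) (w : ℂ) (x : Fin 3 → ℂ) :
    factor ε γ w x (QuotientAddGroup.mk δ) =
      1 - exp (ε * (2 * Real.pi * I) * (formEval δ x - w) / formEval γ x) := rfl

theorem Admissible.mk_eq_mk (h : Admissible ε a b γ x) {δ δ' : Fin 3 → ℤ}
    (ha : δ ⬝ᵥ a = δ' ⬝ᵥ a) (hb : δ ⬝ᵥ b = δ' ⬝ᵥ b) :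
    (QuotientAddGroup.mk δ : (Fin 3 → ℤ) ⧸ AddSubgroup.zmultiples γ) = QuotientAddGroup.mk δ' := by
  rw [QuotientAddGroup.eq]
  refine h.mem_zmultiples _ ?_ ?_
  · rw [add_dotProduct, neg_dotProduct, ha, neg_add_cancel]
  · rw [add_dotProduct, neg_dotProduct, hb, neg_add_cancel]

theorem Admissible.dot_add_zsmul (h : Admissible ε a b γ x) (δ : Fin 3 → ℤ) (n : ℤ) :
    (δ + n • γ) ⬝ᵥ a = δ ⬝ᵥ a ∧ (δ + n • γ) ⬝ᵥ b = δ ⬝ᵥ b := by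
  constructor
  · rw [add_dotProduct, smul_dotProduct, h.dot_left, smul_zero, add_zero]
  · rw [add_dotProduct, smul_dotProduct, h.dot_right, smul_zero, add_zero]

theorem Admissible.factor_eq_zero (h : Admissible ε a b γ x)
    {q : (Fin 3 → ℤ) ⧸ AddSubgroup.zmultiples γ} (hq : q ∈ orbits (cone a b) γ) {w : ℂ}
    (h0 : factor ε γ w x q = 0) : ∃ δ ∈ cone a b, w = formEval δ x := by
  obtain ⟨δ, hδ, rfl⟩ := hq
  obtain ⟨n, hn⟩ := exp_eq_one_iff.1 (sub_eq_zero.1 h0).symm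
  have hg := h.ne_zero
  have hpi : (Real.pi : ℂ) ≠ 0 := by exact_mod_cast Real.pi_ne_zero
  have he : (ε : ℂ) * ε = 1 := by exact_mod_cast h.sq_eq_one
  -- A vanishing factor means ε(δ(x) - w)/γ(x) = n, and ε² = 1, so w is the value of this translate
  -- of δ.
  refine ⟨δ + (-(ε * n)) • γ, ?_, ?_⟩
  · obtain ⟨h1, h2⟩ := h.dot_add_zsmul δ (-(ε * n))
    exact ⟨by rw [h1]; exact hδ.1, by rw [h2]; exact hδ.2⟩
  · rw [formEval_add, formEval_zsmul]
    field_simp at hn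
    push_cast
    linear_combination (-(ε : ℂ)) * hn + (formEval δ x - w) * he

theorem Admissible.exists_factor_eq_zero {δ : Fin 3 → ℤ} (hδ : δ ∈ cone a b) :
    ∃ q : orbits (cone a b) γ, factor ε γ (formEval δ x) x q = 0 := by
  refine ⟨⟨_, δ, hδ, rfl⟩, ?_⟩
  rw [factor_mk]
  simp

/-- The part of the factor depending on `δ` only decays geometrically. -/
theorem Admissible.exists_summable (h : Admissible ε a b γ x) :
    ∃ u : orbits (cone a b) γ → ℝ, Summable u ∧ ∀ (q : orbits (cone a b) γ) w, ∃ v : ℂ, factor ε γ w x q =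
      1 + v * exp (-(ε * (2 * Real.pi * I)) * w / formEval γ x) ∧ ‖v‖ = u q := by
  obtain ⟨A, hA, B, hB, him⟩ := h.exists_im
  choose δ hδ hq using fun q : orbits (cone a b) γ => q.2
  set r : ℝ := Real.exp (-(2 * Real.pi * A)) with hr
  set s : ℝ := Real.exp (-(2 * Real.pi * B)) with hs
  have hr1 : r < 1 := by rw [hr, Real.exp_lt_one_iff, neg_lt_zero]; positivity
  have hs1 : s < 1 := by rw [hs, Real.exp_lt_one_iff, neg_lt_zero]; positivity
  have hsum : Summable fun p : ℕ × ℕ => r ^ p.1 * s ^ p.2 :=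
    (summable_geometric_of_lt_one (Real.exp_nonneg _) hr1).mul_of_nonneg
      (summable_geometric_of_lt_one (Real.exp_nonneg _) hs1) (fun _ => by positivity)
      (fun _ => by positivity)
  -- An orbit is determined by (δ(a), -δ(b)), and the modulus of its exponential is geometric in
  -- these two numbers.
  set φ : orbits (cone a b) γ → ℕ × ℕ := fun q => ((δ q ⬝ᵥ a).toNat, (-(δ q ⬝ᵥ b)).toNat) with hφ
  have hinj : Function.Injective φ := by
    intro q q' hqq
    simp only [hφ, Prod.mk.injEq] at hqq
    have h1 := (hδ q).1
    have h2 := (hδ q).2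
    have h3 := (hδ q').1
    have h4 := (hδ q').2
    apply Subtype.ext
    rw [← hq q, ← hq q']
    exact h.mk_eq_mk (by omega) (by omega)
  refine ⟨_, hsum.comp_injective hinj, fun q w => ?_⟩
  refine ⟨-exp (ε * (2 * Real.pi * I) * formEval (δ q) x / formEval γ x), ?_, ?_⟩
  · rw [← hq q, factor_mk, sub_eq_add_neg, neg_mul, ← exp_add]
    congr 3
    ring
  · have h1 : (δ q ⬝ᵥ a : ℤ) = ((δ q ⬝ᵥ a).toNat : ℤ) := (Int.toNat_of_nonneg (hδ q).1.le).symm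
    have h2 : -(δ q ⬝ᵥ b : ℤ) = ((-(δ q ⬝ᵥ b)).toNat : ℤ) :=
      (Int.toNat_of_nonneg (by have := (hδ q).2; omega)).symm
    have h1' : ((δ q ⬝ᵥ a : ℤ) : ℝ) = ((δ q ⬝ᵥ a).toNat : ℝ) := by exact_mod_cast h1
    have h2' : -((δ q ⬝ᵥ b : ℤ) : ℝ) = ((-(δ q ⬝ᵥ b)).toNat : ℝ) := by exact_mod_cast h2
    have h3 := him (δ q)
    rw [norm_neg, norm_exp]
    simp only [Function.comp, hφ, hr, hs]
    rw [← Real.exp_nat_mul, ← Real.exp_nat_mul, ← Real.exp_add, ← h1', ← h2']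
    congr 1
    have h4 : ((ε : ℂ) * (2 * Real.pi * I) * formEval (δ q) x / formEval γ x).re =
        -(2 * Real.pi * (ε * (formEval (δ q) x / formEval γ x).im)) := by
      have : (ε : ℂ) * (2 * Real.pi * I) * formEval (δ q) x / formEval γ x =
        ((2 * Real.pi * ε : ℝ) : ℂ) * (I * (formEval (δ q) x / formEval γ x)) := by
        push_cast; ring
      rw [this, re_ofReal_mul, I_mul_re]
      ring
    rw [h4, h3]
    ring

theorem Admissible.summable_norm (h : Admissible ε a b γ x) (w : ℂ) :
    Summable fun q : orbits (cone a b) γ => ‖factor ε γ w x q - 1‖ := by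
  obtain ⟨u, hu, hv⟩ := h.exists_summable
  refine (hu.mul_right ‖exp (-(ε * (2 * Real.pi * I)) * w / formEval γ x)‖).congr fun q => ?_
  obtain ⟨v, h1, h2⟩ := hv q w
  rw [h1, add_sub_cancel_left, norm_mul, h2]

theorem Admissible.multipliable (h : Admissible ε a b γ x) (w : ℂ) :
    Multipliable fun q : orbits (cone a b) γ => factor ε γ w x q := by
  have := multipliable_one_add_of_summable (h.summable_norm w)
  simpa using this

theorem Admissible.wedgeProd_ne_zero (h : Admissible ε a b γ x) {w : ℂ}
    (hw : ∀ δ ∈ cone a b, w ≠ formEval δ x) : wedgeProd ε a b γ x w ≠ 0 := by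
  have := tprod_one_add_ne_zero_of_summable
    (f := fun q : orbits (cone a b) γ => factor ε γ w x q - 1) (fun q h0 => ?_) (h.summable_norm w)
  · simpa [wedgeProd] using this
  · rw [add_sub_cancel] at h0
    obtain ⟨δ, hδ, hw'⟩ := h.factor_eq_zero q.2 h0
    exact hw δ hδ hw'

theorem Admissible.wedgeProd_eq_zero {δ : Fin 3 → ℤ} (hδ : δ ∈ cone a b) :
    wedgeProd ε a b γ x (formEval δ x) = 0 :=
  tprod_of_exists_eq_zero (exists_factor_eq_zero hδ)

/-- The Weierstrass test on the unit ball about each point: only a factor bounded there depends on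
w, and the rest is summable. -/
theorem Admissible.differentiable (h : Admissible ε a b γ x) :
    Differentiable ℂ (wedgeProd ε a b γ x) := by
  obtain ⟨u, hu, hv⟩ := h.exists_summable
  intro w₀
  have hloc : IsCompact (Metric.closedBall w₀ 1) := isCompact_closedBall _ _
  have hfac : ∀ q : (Fin 3 → ℤ) ⧸ AddSubgroup.zmultiples γ,
      Differentiable ℂ fun w => factor ε γ w x q := by
    intro q
    obtain ⟨δ, rfl⟩ := QuotientAddGroup.mk_surjective q
    simp only [factor_mk]
    fun_prop
  obtain ⟨M, hM⟩ := hloc.exists_bound_of_continuousOn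
    (f := fun w => exp (-(ε * (2 * Real.pi * I)) * w / formEval γ x)) (by fun_prop)
  have key := (hu.mul_right M).hasProdLocallyUniformlyOn_one_add
    (f := fun (q : orbits (cone a b) γ) w => factor ε γ w x q - 1) (K := Metric.ball w₀ 1)
    Metric.isOpen_ball (Eventually.of_forall fun q w hw => ?_)
    fun q => ((hfac q).continuous.sub continuous_const).continuousOn
  · have h1 : DifferentiableOn ℂ (fun w => ∏' q : orbits (cone a b) γ, (1 + (factor ε γ w x q - 1)))
        (Metric.ball w₀ 1) := by
      refine key.differentiableOn (Eventually.of_forall fun S => ?_) Metric.isOpen_ball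
      refine (Differentiable.fun_finsetProd fun q _ => ?_).differentiableOn
      simpa using hfac q
    simp only [add_sub_cancel] at h1
    exact (h1 w₀ (Metric.mem_ball_self one_pos)).differentiableAt
      (Metric.isOpen_ball.mem_nhds (Metric.mem_ball_self one_pos))
  · obtain ⟨v, h1, h2⟩ := hv q w
    rw [h1, add_sub_cancel_left, norm_mul, h2]
    exact mul_le_mul_of_nonneg_left (hM w (Metric.ball_subset_closedBall hw))
      (by rw [← h2]; exact norm_nonneg _)

/-- The map induced on orbits by equality of the groups of translations. -/
noncomputable def orbitsEquiv (C : Set (Fin 3 → ℤ)) {γ γ' : Fin 3 → ℤ}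
    (h : AddSubgroup.zmultiples γ = AddSubgroup.zmultiples γ') : orbits C γ ≃ orbits C γ' :=
  (QuotientAddGroup.quotientAddEquivOfEq h).toEquiv.subtypeEquiv fun q => by
    constructor
    · rintro ⟨δ, hδ, rfl⟩
      exact ⟨δ, hδ, rfl⟩
    · rintro ⟨δ, hδ, hq⟩
      refine ⟨δ, hδ, (QuotientAddGroup.quotientAddEquivOfEq h).injective ?_⟩
      exact hq

/-- Only the ratio ε/γ(x) enters the factors, and ±γ generate the same group. This is the symmetry
behind `Gam_swap`. -/
theorem wedgeProd_neg (ε : ℤ) (a b γ : Fin 3 → ℤ) (x : Fin 3 → ℂ) (w : ℂ) :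
    wedgeProd (-ε) a b (-γ) x w = wedgeProd ε a b γ x w := by
  unfold wedgeProd
  have hz : AddSubgroup.zmultiples γ = AddSubgroup.zmultiples (-γ) := by
    rw [AddSubgroup.zmultiples_neg]
  rw [← (orbitsEquiv (cone a b) hz).tprod_eq]
  refine tprod_congr fun q => ?_
  obtain ⟨_, δ, hδ, rfl⟩ := q
  change factor (-ε) (-γ) w x (QuotientAddGroup.mk δ) = factor ε γ w x (QuotientAddGroup.mk δ)
  rw [factor_mk, factor_mk, formEval_neg]
  congr 2
  push_cast
  rw [div_neg, neg_mul, neg_mul, neg_div, neg_neg]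

end

/-! ### The two term relation -/

section

open Filter Topology Complex
open scoped Matrix

variable {a b : Fin 3 → ℤ} {x : Fin 3 → ℂ}

theorem Gam_self (a : Fin 3 → ℤ) (w : ℂ) (x : Fin 3 → ℂ) : Gam a a w x = 1 := if_pos rfl

theorem Gam_eq_div (h : a ⨯₃ b ≠ 0) (w : ℂ) (x : Fin 3 → ℂ) :
    Gam a b w x = wedgeProd (-1) a b (directionVector a b) x w /
      wedgeProd 1 b a (directionVector a b) x w := by
  have hab : a ≠ b := by rintro rfl; exact h (cross_self a)
  exact if_neg hab

theorem Gam_swap (h : a ⨯₃ b ≠ 0) (w : ℂ) (x : Fin 3 → ℂ) :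
    Gam b a w x = (Gam a b w x)⁻¹ := by
  have h1 := wedgeProd_neg 1 b a (directionVector a b) x w
  have h2 := wedgeProd_neg (-1) a b (directionVector a b) x w
  rw [neg_neg] at h2
  rw [Gam_eq_div h, Gam_eq_div (cross_swap_ne_zero h), directionVector_swap h, inv_div, h1, h2]

theorem wedgeProd_ne_zero_of_notMem (h : a ⨯₃ b ≠ 0) (ha : 0 < wt a x) (hb : 0 < wt b x) {w : ℂ}
    (hw : w ∉ zerosPoles a b x) : wedgeProd (-1) a b (directionVector a b) x w ≠ 0 ∧
      wedgeProd 1 b a (directionVector a b) x w ≠ 0 :=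
  ⟨(admissible_num h ha hb).wedgeProd_ne_zero fun δ hδ hwδ => hw ⟨δ, Or.inl hδ, hwδ⟩,
    (admissible_den h ha hb).wedgeProd_ne_zero fun δ hδ hwδ => hw ⟨δ, Or.inr hδ, hwδ⟩⟩

theorem Gam_ne_zero (h : a ⨯₃ b ≠ 0) (ha : 0 < wt a x) (hb : 0 < wt b x) {w : ℂ}
    (hw : w ∉ zerosPoles a b x) : Gam a b w x ≠ 0 := by
  obtain ⟨h1, h2⟩ := wedgeProd_ne_zero_of_notMem h ha hb hw
  rw [Gam_eq_div h]
  exact div_ne_zero h1 h2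

theorem meromorphic_Gam (h : a ⨯₃ b ≠ 0) (ha : 0 < wt a x) (hb : 0 < wt b x) :
    Meromorphic fun w => Gam a b w x := by
  intro w
  have h1 := ((admissible_num h ha hb).differentiable.analyticAt w).meromorphicAt
  have h2 := ((admissible_den h ha hb).differentiable.analyticAt w).meromorphicAt
  have h3 := h1.div h2
  refine h3.congr (Eventually.of_forall fun u => ?_)
  exact (Gam_eq_div h u x).symm

theorem countable_zerosPoles (a b : Fin 3 → ℤ) (x : Fin 3 → ℂ) : (zerosPoles a b x).Countable := by
  refine (Set.countable_range fun δ : Fin 3 → ℤ => formEval δ x).mono ?_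
  rintro w ⟨δ, -, rfl⟩
  exact ⟨δ, rfl⟩

theorem zerosPoles_self (a : Fin 3 → ℤ) (x : Fin 3 → ℂ) : zerosPoles a a x = ∅ := by
  refine Set.eq_empty_of_forall_notMem ?_
  rintro w ⟨δ, hδ, -⟩
  rw [Set.union_self] at hδ
  exact absurd hδ.1 (not_lt.2 hδ.2)

theorem zerosPoles_swap (a b : Fin 3 → ℤ) (x : Fin 3 → ℂ) : zerosPoles b a x = zerosPoles a b x := by
  unfold zerosPoles
  rw [Set.union_comm]

/-- The set lies in the zero set of the entire function numerator times denominator, which is not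
identically zero because the set is countable. -/
theorem compl_zerosPoles_mem_codiscrete (h : a ⨯₃ b ≠ 0) (ha : 0 < wt a x) (hb : 0 < wt b x) :
    (zerosPoles a b x)ᶜ ∈ codiscrete ℂ := by
  set f : ℂ → ℂ := fun w => wedgeProd (-1) a b (directionVector a b) x w *
    wedgeProd 1 b a (directionVector a b) x w with hf
  have hd : Differentiable ℂ f :=
    (admissible_num h ha hb).differentiable.mul (admissible_den h ha hb).differentiable
  obtain ⟨w, hw⟩ := ((countable_zerosPoles a b x).dense_compl ℝ).nonempty
  have hw0 : f w ≠ 0 := by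
    obtain ⟨h1, h2⟩ := wedgeProd_ne_zero_of_notMem h ha hb hw
    exact mul_ne_zero h1 h2
  have han : AnalyticOnNhd ℂ f Set.univ := fun u _ => hd.analyticAt u
  have := han.preimage_zero_mem_codiscrete hw0
  refine mem_of_superset this ?_
  rintro u hu ⟨δ, hδ, rfl⟩
  apply hu
  rcases hδ with hδ | hδ
  · simp [hf, Admissible.wedgeProd_eq_zero hδ]
  · simp [hf, Admissible.wedgeProd_eq_zero hδ]

theorem wt_neg (a : Fin 3 → ℤ) (x : Fin 3 → ℂ) : wt (-a) x = -wt a x := by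
  have := wt_smul (-1) a x
  simpa using this

/-- `wt` is odd, so b = -a is excluded when both weights are positive. -/
theorem eq_or_cross_ne_zero (ha : IsPrimitive a) (hb : IsPrimitive b) (hxa : 0 < wt a x)
    (hxb : 0 < wt b x) : b = a ∨ a ⨯₃ b ≠ 0 := by
  by_cases h : a ⨯₃ b = 0
  · rcases ha.eq_or_eq_neg hb h with h1 | h1
    · exact Or.inl h1
    · rw [h1, wt_neg] at hxb
      linarith
  · exact Or.inr h

theorem Gam_mul_Gam_swap (ha : IsPrimitive a) (hb : IsPrimitive b) (hxa : 0 < wt a x)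
    (hxb : 0 < wt b x) {w : ℂ} (hw : w ∉ zerosPoles a b x) :
    Gam a b w x * Gam b a w x = 1 := by
  rcases eq_or_cross_ne_zero ha hb hxa hxb with rfl | h
  · rw [Gam_self, one_mul]
  · rw [Gam_swap h, mul_inv_cancel₀ (Gam_ne_zero h hxa hxb hw)]

theorem isEmpty_orbits_cone_self (a γ : Fin 3 → ℤ) : IsEmpty (orbits (cone a a) γ) := by
  refine ⟨?_⟩
  rintro ⟨_, δ, hδ, -⟩
  exact absurd hδ.1 (not_lt.2 hδ.2)

theorem Gam_two_term (ha : IsPrimitive a) (hb : IsPrimitive b) (hx : x ∈ UPlus a ∩ UPlus b) :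
    (∀ w : ℂ, Multipliable (numFactor a b w x) ∧ Multipliable (denFactor a b w x)) ∧
      Meromorphic (fun w : ℂ => Gam a b w x) ∧ (zerosPoles a b x)ᶜ ∈ codiscrete ℂ ∧
      ∀ w : ℂ, w ∉ zerosPoles a b x → Gam a b w x * Gam b a w x = 1 := by
  have hxa := wt_pos ha.ne_zero hx.1
  have hxb := wt_pos hb.ne_zero hx.2
  refine ⟨?_, ?_, ?_, fun w => Gam_mul_Gam_swap ha hb hxa hxb⟩ <;>
    rcases eq_or_cross_ne_zero ha hb hxa hxb with rfl | h
  · intro w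
    have := isEmpty_orbits_cone_self b (directionVector b b)
    exact ⟨multipliable_empty, multipliable_empty⟩
  · exact fun w => ⟨(admissible_num h hxa hxb).multipliable w,
      (admissible_den h hxa hxb).multipliable w⟩
  · simp only [Gam_self]
    exact fun w => MeromorphicAt.const 1 w
  · exact meromorphic_Gam h hxa hxb
  · rw [zerosPoles_self, Set.compl_empty]
    exact univ_mem
  · exact compl_zerosPoles_mem_codiscrete h hxa hxb

end

/-! ### The three term relation for coplanar vectors -/

section

open scoped Matrix

variable {a b c : Fin 3 → ℤ} {x : Fin 3 → ℂ}

/-- The value δ(b) is a positive combination of δ(a) and δ(c), so it is ≤ 0 when both are, and > 0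
when both are. -/
theorem cone_eq_union {n p q : ℤ} (hn : 0 < n) (hp : 0 < p) (hq : 0 < q)
    (h : n • b = p • a + q • c) : cone a c = cone a b ∪ cone b c := by
  ext δ
  have h1 : n * (δ ⬝ᵥ b) = p * (δ ⬝ᵥ a) + q * (δ ⬝ᵥ c) := by
    have := congrArg (δ ⬝ᵥ ·) h
    simpa only [dotProduct_add, dotProduct_smul, smul_eq_mul] using this
  simp only [cone, Set.mem_union, Set.mem_ofPred_eq]
  generalize δ ⬝ᵥ a = A at *
  generalize δ ⬝ᵥ b = B at *
  generalize δ ⬝ᵥ c = C at *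
  constructor
  · rintro ⟨hA, hC⟩
    rcases le_or_gt B 0 with hB | hB
    · exact Or.inl ⟨hA, hB⟩
    · exact Or.inr ⟨hB, hC⟩
  · rintro (⟨hA, hB⟩ | ⟨hB, hC⟩)
    · refine ⟨hA, ?_⟩
      by_contra hC
      nlinarith [mul_pos hp hA, mul_pos hq (not_le.1 hC)]
    · refine ⟨?_, hC⟩
      by_contra hA
      nlinarith [mul_pos hn hB]

theorem wedgeProd_mul_wedgeProd {ε : ℤ} {γ : Fin 3 → ℤ} (h₁ : Admissible ε a b γ x)
    (h₂ : Admissible ε b c γ x) (hC : cone a c = cone a b ∪ cone b c) (w : ℂ) :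
    wedgeProd ε a b γ x w * wedgeProd ε b c γ x w = wedgeProd ε a c γ x w := by
  have hdisj : Disjoint (orbits (cone a b) γ) (orbits (cone b c) γ) := by
    rw [Set.disjoint_left]
    rintro _ ⟨δ, hδ, rfl⟩ ⟨δ', hδ', he⟩
    obtain ⟨n, hn⟩ := AddSubgroup.mem_zmultiples_iff.1 (QuotientAddGroup.eq.1 he)
    have h3 := (h₁.dot_add_zsmul δ' n).2
    rw [hn, add_neg_cancel_left] at h3
    have h4 := hδ.2
    have h5 := hδ'.1
    omega
  have h3 := Multipliable.tprod_union_disjoint (f := fun q => factor ε γ w x q) hdisj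
    (h₁.multipliable w) (h₂.multipliable w)
  unfold wedgeProd
  rw [← h3, hC, orbits, orbits, orbits, Set.image_union]

/-- With b strictly between a and c the three wedges share one direction vector, and both the
numerator and the denominator cones split at b. -/
theorem Gam_mul_Gam_of_between {n p q : ℤ} (hn : 0 < n) (hp : 0 < p) (hq : 0 < q)
    (h : n • b = p • a + q • c) (hac : a ⨯₃ c ≠ 0) (hxa : 0 < wt a x) (hxb : 0 < wt b x)
    (hxc : 0 < wt c x) (w : ℂ) : Gam a b w x * Gam b c w x = Gam a c w x := by
  have e1 : n • (a ⨯₃ b) = q • (a ⨯₃ c) := by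
    have := congrArg (fun u => a ⨯₃ u) h
    simpa only [map_smul, map_add, cross_self, smul_zero, zero_add] using this
  have e2 : n • (b ⨯₃ c) = p • (a ⨯₃ c) := by
    have := congrArg (fun u => u ⨯₃ c) h
    simpa only [map_smul, map_add, LinearMap.smul_apply, LinearMap.add_apply, cross_self, smul_zero,
      add_zero] using this
  have hab : a ⨯₃ b ≠ 0 := fun h0 => by
    rw [h0, smul_zero] at e1
    exact hac ((smul_eq_zero.1 e1.symm).resolve_left hq.ne')
  have hbc : b ⨯₃ c ≠ 0 := fun h0 => by
    rw [h0, smul_zero] at e2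
    exact hac ((smul_eq_zero.1 e2.symm).resolve_left hp.ne')
  obtain ⟨s, hs, hd⟩ := exists_cross_eq_smul hac
  have hγ := directionVector_isPrimitive hac
  have d1 : directionVector a b = directionVector a c :=
    directionVector_eq hab hγ hn (mul_pos hq hs) (by rw [e1, hd, smul_smul])
  have d2 : directionVector b c = directionVector a c :=
    directionVector_eq hbc hγ hn (mul_pos hp hs) (by rw [e2, hd, smul_smul])
  have a1 := admissible_num hab hxa hxb
  have a2 := admissible_num hbc hxb hxc
  have a3 := admissible_den hab hxa hxb
  have a4 := admissible_den hbc hxb hxc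
  rw [d1] at a1 a3
  rw [d2] at a2 a4
  rw [Gam_eq_div hab, Gam_eq_div hbc, Gam_eq_div hac, d1, d2, div_mul_div_comm,
    wedgeProd_mul_wedgeProd a1 a2 (cone_eq_union hn hp hq h),
    mul_comm (wedgeProd 1 b a _ x w),
    wedgeProd_mul_wedgeProd a4 a3 (cone_eq_union hn hq hp (by rw [h, add_comm]))]

/-- The weights place the three vectors in an open half-plane, so one of them lies between the other
two; the signs of the coefficients in `key` tell which. -/
theorem exists_between (ha : 0 < wt a x) (hb : 0 < wt b x) (hc : 0 < wt c x) (hab : a ⨯₃ b ≠ 0)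
    (hbc : b ⨯₃ c ≠ 0) (hac : a ⨯₃ c ≠ 0) (hdet : (a ⨯₃ b) ⬝ᵥ c = 0) :
    ∃ n p q : ℤ, 0 < n ∧ 0 < p ∧ 0 < q ∧
      (n • b = p • a + q • c ∨ n • c = p • b + q • a ∨ n • a = p • c + q • b) := by
  set S := (a ⨯₃ b) ⬝ᵥ (a ⨯₃ b) with hS
  set T := (a ⨯₃ b) ⬝ᵥ (b ⨯₃ c) with hT
  set U := (a ⨯₃ b) ⬝ᵥ (a ⨯₃ c) with hU
  have hSpos : 0 < S := by
    refine lt_of_le_of_ne ?_ (fun h0 => hab (dotProduct_self_eq_zero.1 h0.symm))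
    exact Finset.sum_nonneg fun i _ => mul_self_nonneg _
  -- The linear relation with coefficients normalised so that that of c is |a × b|² > 0.
  have key : U • b = T • a + S • c := by
    have h0 : ((a ⨯₃ b) ⬝ᵥ c) • (a ⨯₃ b) = T • a + S • c - U • b := by
      funext i
      fin_cases i <;> simp [hS, hT, hU, cross_apply, dotProduct, Fin.sum_univ_three] <;> ring
    rw [hdet, zero_smul] at h0
    exact (sub_eq_zero.1 h0.symm).symm
  have hwt : (U : ℝ) * wt b x = T * wt a x + S * wt c x := by
    rw [← wt_smul, key, ← wt_smul, ← wt_smul]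
    simp [wt, dotProduct, Fin.sum_univ_three]
    ring
  have hT0 : T ≠ 0 := by
    intro h0
    have h1 := congrArg (fun u => b ⨯₃ u) key
    simp only [h0, zero_smul, zero_add, map_smul, cross_self, smul_zero] at h1
    exact hbc ((smul_eq_zero.1 h1.symm).resolve_left hSpos.ne')
  have hU0 : U ≠ 0 := by
    intro h0
    have h1 := congrArg (fun u => a ⨯₃ u) key
    simp only [h0, zero_smul, map_add, map_smul, cross_self, smul_zero, zero_add, map_zero] at h1
    exact hac ((smul_eq_zero.1 h1.symm).resolve_left hSpos.ne')
  have hSr : (0 : ℝ) < S := by exact_mod_cast hSpos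
  rcases lt_or_gt_of_ne hT0 with hTn | hTp
  · rcases lt_or_gt_of_ne hU0 with hUn | hUp
    · refine ⟨-T, S, -U, by omega, hSpos, by omega, Or.inr (Or.inr ?_)⟩
      rw [neg_smul, neg_smul, key]
      abel
    · refine ⟨S, U, -T, hSpos, hUp, by omega, Or.inr (Or.inl ?_)⟩
      rw [neg_smul, key]
      abel
  · have hUp : 0 < U := by
      have hTr : (0 : ℝ) < T := by exact_mod_cast hTp
      have : 0 < (U : ℝ) * wt b x := by rw [hwt]; positivity
      exact_mod_cast (pos_iff_pos_of_mul_pos this).2 hb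
    exact ⟨U, T, S, hUp, hTp, hSpos, Or.inl key⟩

/-- The three term relation for coplanar vectors. -/
theorem Gam_three_term_coplanar (hpa : IsPrimitive a) (hpb : IsPrimitive b) (hpc : IsPrimitive c)
    (ha : 0 < wt a x) (hb : 0 < wt b x) (hc : 0 < wt c x) (hdet : (a ⨯₃ b) ⬝ᵥ c = 0) {w : ℂ}
    (hab : w ∉ zerosPoles a b x) (hbc : w ∉ zerosPoles b c x) (hca : w ∉ zerosPoles c a x) :
    Gam a b w x * Gam b c w x * Gam c a w x = 1 := by
  rcases eq_or_cross_ne_zero hpa hpb ha hb with rfl | nab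
  · rw [Gam_self, one_mul, Gam_mul_Gam_swap hpb hpc hb hc hbc]
  rcases eq_or_cross_ne_zero hpb hpc hb hc with rfl | nbc
  · rw [Gam_self, mul_one, Gam_mul_Gam_swap hpa hpc ha hc hab]
  rcases eq_or_cross_ne_zero hpc hpa hc ha with rfl | nca
  · rw [Gam_self, mul_one, Gam_mul_Gam_swap hpa hpb ha hb hab]
  have nac := cross_swap_ne_zero nca
  obtain ⟨n, p, q, hn, hp, hq, h | h | h⟩ := exists_between ha hb hc nab nbc nac hdet
  · rw [Gam_mul_Gam_of_between hn hp hq h nac ha hb hc, mul_comm,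
      Gam_mul_Gam_swap hpc hpa hc ha hca]
  · rw [mul_assoc, Gam_mul_Gam_of_between hn hp hq h (cross_swap_ne_zero nab) hb hc ha,
      Gam_mul_Gam_swap hpa hpb ha hb hab]
  · rw [mul_comm, ← mul_assoc,
      Gam_mul_Gam_of_between hn hp hq h (cross_swap_ne_zero nbc) hc ha hb, mul_comm,
      Gam_mul_Gam_swap hpb hpc hb hc hbc]

end

/-! ### Dual frames and the decomposition of a cone into translates of a box -/

section

open Filter Topology Complex
open scoped Matrix

theorem eq_of_add_mul_eq {A r r' m m' : ℤ} (hr : 0 < r) (hrA : r ≤ A) (hr' : 0 < r') (hrA' : r' ≤ A)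
    (h : r + m * A = r' + m' * A) : r = r' ∧ m = m' := by
  have hm : m = m' := by
    rcases lt_trichotomy m m' with h1 | h1 | h1
    · nlinarith [mul_le_mul_of_nonneg_right (show m + 1 ≤ m' by omega) (hr.trans_le hrA).le]
    · exact h1
    · nlinarith [mul_le_mul_of_nonneg_right (show m' + 1 ≤ m by omega) (hr.trans_le hrA).le]
  subst hm
  exact ⟨by linarith, rfl⟩

theorem exists_add_mul_eq {A : ℤ} (hA : 0 < A) (u : ℤ) :
    ∃ r m : ℤ, 0 < r ∧ r ≤ A ∧ u = r + m * A := by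
  refine ⟨(u - 1) % A + 1, (u - 1) / A, ?_, ?_, ?_⟩
  · have := Int.emod_nonneg (u - 1) hA.ne'
    omega
  · have := Int.emod_lt_of_pos (u - 1) hA
    omega
  · have := Int.emod_add_mul_ediv (u - 1) A
    linarith [mul_comm A ((u - 1) / A)]

/-- The forms `α, β, γ` are positive multiples of the basis dual to `a, b, c`. -/
structure IsDualFrame (a b c α β γ : Fin 3 → ℤ) : Prop where
  αa : 0 < α ⬝ᵥ a
  αb : α ⬝ᵥ b = 0
  αc : α ⬝ᵥ c = 0
  βa : β ⬝ᵥ a = 0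
  βb : 0 < β ⬝ᵥ b
  βc : β ⬝ᵥ c = 0
  γa : γ ⬝ᵥ a = 0
  γb : γ ⬝ᵥ b = 0
  γc : 0 < γ ⬝ᵥ c

theorem IsDualFrame.rotate {a b c α β γ : Fin 3 → ℤ} (h : IsDualFrame a b c α β γ) :
    IsDualFrame b c a β γ α :=
  ⟨h.βb, h.βc, h.βa, h.γb, h.γc, h.γa, h.αb, h.αc, h.αa⟩

theorem IsDualFrame.swap {a b c α β γ : Fin 3 → ℤ} (h : IsDualFrame a b c α β γ) :
    IsDualFrame b a c β α γ :=
  ⟨h.βb, h.βa, h.βc, h.αb, h.αa, h.αc, h.γb, h.γa, h.γc⟩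

/-- The lattice points of the half-open parallelepiped spanned by `α, β, γ`. -/
def InBox (a b c α β γ δ : Fin 3 → ℤ) : Prop :=
  (0 < δ ⬝ᵥ a ∧ δ ⬝ᵥ a ≤ α ⬝ᵥ a) ∧ (0 < δ ⬝ᵥ b ∧ δ ⬝ᵥ b ≤ β ⬝ᵥ b) ∧ (0 < δ ⬝ᵥ c ∧ δ ⬝ᵥ c ≤ γ ⬝ᵥ c)

theorem InBox.rotate {a b c α β γ δ : Fin 3 → ℤ} :
    InBox b c a β γ α δ ↔ InBox a b c α β γ δ := by
  unfold InBox; tauto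

theorem InBox.swap {a b c α β γ δ : Fin 3 → ℤ} :
    InBox b a c β α γ δ ↔ InBox a b c α β γ δ := by
  unfold InBox; tauto

variable {ε : ℤ} {a b c α β γ : Fin 3 → ℤ} {x : Fin 3 → ℂ}

/-- The difference is a multiple of γ that vanishes at c, hence zero. -/
theorem Admissible.eq_of_dot_eq (h : Admissible ε a b γ x) (hγc : 0 < γ ⬝ᵥ c) {δ δ' : Fin 3 → ℤ}
    (ha : δ ⬝ᵥ a = δ' ⬝ᵥ a) (hb : δ ⬝ᵥ b = δ' ⬝ᵥ b) (hc : δ ⬝ᵥ c = δ' ⬝ᵥ c) : δ = δ' := by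
  obtain ⟨n, hn⟩ := AddSubgroup.mem_zmultiples_iff.1 (h.mem_zmultiples (δ - δ')
    (by rw [sub_dotProduct, ha, sub_self]) (by rw [sub_dotProduct, hb, sub_self]))
  have h1 := congrArg (· ⬝ᵥ c) hn
  simp only [smul_dotProduct, sub_dotProduct, hc, sub_self, smul_eq_mul] at h1
  rw [(mul_eq_zero.1 h1).resolve_right hγc.ne', zero_smul] at hn
  exact (sub_eq_zero.1 hn.symm)

theorem Admissible.finite_box (h : Admissible ε a b γ x) (hf : IsDualFrame a b c α β γ) :
    {δ | InBox a b c α β γ δ}.Finite := by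
  refine Set.Finite.of_injOn (f := fun δ => ((δ ⬝ᵥ a, δ ⬝ᵥ b), δ ⬝ᵥ c))
    (t := (Set.Icc 0 (α ⬝ᵥ a) ×ˢ Set.Icc 0 (β ⬝ᵥ b)) ×ˢ Set.Icc 0 (γ ⬝ᵥ c)) ?_ ?_
    (((Set.finite_Icc _ _).prod (Set.finite_Icc _ _)).prod (Set.finite_Icc _ _))
  · rintro δ ⟨h1, h2, h3⟩
    exact ⟨⟨⟨h1.1.le, h1.2⟩, h2.1.le, h2.2⟩, h3.1.le, h3.2⟩
  · intro δ _ δ' _ he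
    simp only [Prod.mk.injEq] at he
    exact h.eq_of_dot_eq hf.γc he.1.1 he.1.2 he.2

/-- The cone modulo `γ` is freely generated by the box under the translations by `α` and `-β`. -/
theorem Admissible.wedgeProd_eq_prod (h : Admissible ε a b γ x) (hf : IsDualFrame a b c α β γ)
    (B : Finset (Fin 3 → ℤ)) (hB : ∀ δ, δ ∈ B ↔ InBox a b c α β γ δ) (w : ℂ)
    (P : (Fin 3 → ℤ) → ℂ)
    (hP : ∀ δ ∈ B, HasProd (fun p : ℕ × ℕ => 1 - exp (ε * (2 * Real.pi * I) *
      (formEval δ x + p.1 * formEval α x - (p.2 + 1) * formEval β x - w) / formEval γ x)) (P δ)) :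
    wedgeProd ε a b γ x w = ∏ δ ∈ B, P δ := by
  set g : B × (ℕ × ℕ) → (Fin 3 → ℤ) := fun p =>
    p.1.1 + (p.2.1 : ℤ) • α - ((p.2.2 : ℤ) + 1) • β with hg
  have hga : ∀ p, g p ⬝ᵥ a = p.1.1 ⬝ᵥ a + (p.2.1 : ℤ) * (α ⬝ᵥ a) := fun p => by
    simp only [hg, sub_dotProduct, add_dotProduct, smul_dotProduct, hf.βa, smul_eq_mul]; ring
  have hgb : ∀ p, g p ⬝ᵥ b = p.1.1 ⬝ᵥ b + (-((p.2.2 : ℤ) + 1)) * (β ⬝ᵥ b) := fun p => by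
    simp only [hg, sub_dotProduct, add_dotProduct, smul_dotProduct, hf.αb, smul_eq_mul]; ring
  have hgc : ∀ p, g p ⬝ᵥ c = p.1.1 ⬝ᵥ c := fun p => by
    simp only [hg, sub_dotProduct, add_dotProduct, smul_dotProduct, hf.αc, hf.βc, smul_eq_mul]; ring
  have hbox : ∀ p : B × (ℕ × ℕ), InBox a b c α β γ p.1.1 := fun p => (hB _).1 p.1.2
  have hmem : ∀ p, g p ∈ cone a b := by
    intro p
    obtain ⟨h1, h2, -⟩ := hbox p
    have hαa := hf.αa
    have hβb := hf.βb
    refine ⟨?_, ?_⟩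
    · rw [hga]
      have : 0 ≤ (p.2.1 : ℤ) * (α ⬝ᵥ a) := by positivity
      linarith [h1.1]
    · rw [hgb]
      have : 0 ≤ (p.2.2 : ℤ) * (β ⬝ᵥ b) := by positivity
      linarith [h2.2]
  set e : B × (ℕ × ℕ) → orbits (cone a b) γ := fun p => ⟨_, g p, hmem p, rfl⟩ with he
  have hinj : Function.Injective e := by
    rintro p p' hpp
    obtain ⟨n, hn⟩ := AddSubgroup.mem_zmultiples_iff.1
      (QuotientAddGroup.eq.1 (congrArg Subtype.val hpp))
    have hn' : g p' = g p + n • γ := by rw [hn]; abel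
    have d1 := (h.dot_add_zsmul (g p) n).1
    have d2 := (h.dot_add_zsmul (g p) n).2
    rw [← hn', hga, hga] at d1
    rw [← hn', hgb, hgb] at d2
    have d3 : g p' ⬝ᵥ c = g p ⬝ᵥ c + n * (γ ⬝ᵥ c) := by
      rw [hn', add_dotProduct, smul_dotProduct, smul_eq_mul]
    rw [hgc, hgc] at d3
    obtain ⟨a1, b1, c1⟩ := hbox p
    obtain ⟨a2, b2, c2⟩ := hbox p'
    obtain ⟨q1, q2⟩ := eq_of_add_mul_eq a2.1 a2.2 a1.1 a1.2 d1
    obtain ⟨q3, q4⟩ := eq_of_add_mul_eq b2.1 b2.2 b1.1 b1.2 d2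
    obtain ⟨q5, -⟩ := eq_of_add_mul_eq (m := 0) (m' := n) c2.1 c2.2 c1.1 c1.2 (by rw [d3]; ring)
    have q6 := h.eq_of_dot_eq hf.γc q1 q3 q5
    refine Prod.ext (Subtype.ext q6.symm) (Prod.ext ?_ ?_)
    · exact_mod_cast q2.symm
    · have : (p'.2.2 : ℤ) = p.2.2 := by linarith
      exact_mod_cast this.symm
  have hsurj : Function.Surjective e := by
    rintro ⟨_, δ, hδ, rfl⟩
    obtain ⟨r, m, hr, hrA, hm⟩ := exists_add_mul_eq hf.αa (δ ⬝ᵥ a)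
    obtain ⟨s, n, hs, hsB, hn⟩ := exists_add_mul_eq hf.βb (δ ⬝ᵥ b)
    obtain ⟨t, l, ht, htC, hl⟩ := exists_add_mul_eq hf.γc (δ ⬝ᵥ c)
    -- Remainders are taken in (0, α(a)] and (0, β(b)]: then δ(a) > 0 is equivalent to m ≥ 0, and
    -- δ(b) ≤ 0 to n ≤ -1, whence the shift n = -(k+1).
    have hm0 : 0 ≤ m := by
      by_contra hlt
      nlinarith [hδ.1, hf.αa, mul_le_mul_of_nonneg_right (show m ≤ -1 by omega) hf.αa.le]
    have hn0 : n ≤ -1 := by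
      by_contra hlt
      nlinarith [hδ.2, hf.βb, mul_le_mul_of_nonneg_right (show 0 ≤ n by omega) hf.βb.le]
    obtain ⟨m, rfl⟩ := Int.eq_ofNat_of_zero_le hm0
    obtain ⟨k, hk⟩ := Int.eq_ofNat_of_zero_le (show 0 ≤ -1 - n by omega)
    have hnk : n = -((k : ℤ) + 1) := by omega
    subst hnk
    set δ₀ := δ - (m : ℤ) • α + ((k : ℤ) + 1) • β - l • γ with hδ₀
    have z1 : δ₀ ⬝ᵥ a = r := by
      simp only [hδ₀, sub_dotProduct, add_dotProduct, smul_dotProduct, hf.βa, hf.γa, smul_eq_mul, hm]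
      ring
    have z2 : δ₀ ⬝ᵥ b = s := by
      simp only [hδ₀, sub_dotProduct, add_dotProduct, smul_dotProduct, hf.αb, hf.γb, smul_eq_mul, hn]
      ring
    have z3 : δ₀ ⬝ᵥ c = t := by
      simp only [hδ₀, sub_dotProduct, add_dotProduct, smul_dotProduct, hf.αc, hf.βc, smul_eq_mul, hl]
      ring
    have hin : δ₀ ∈ B := (hB _).2
      ⟨by rw [z1]; exact ⟨hr, hrA⟩, by rw [z2]; exact ⟨hs, hsB⟩, by rw [z3]; exact ⟨ht, htC⟩⟩
    refine ⟨(⟨δ₀, hin⟩, (m, k)), Subtype.ext ?_⟩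
    refine h.mk_eq_mk ?_ ?_
    · rw [hga, hm, z1]
    · rw [hgb, hn, z2]
  have hprod : HasProd (fun p : B × (ℕ × ℕ) => factor ε γ w x (e p)) (wedgeProd ε a b γ x w) :=
    (Equiv.ofBijective e ⟨hinj, hsurj⟩).hasProd_iff.2 (h.multipliable w).hasProd
  have hfib := hprod.prod_fiberwise (g := fun δ : B => P δ) fun δ => by
    refine (hP δ δ.2).congr_fun fun p => ?_
    simp only [he, hg, factor_mk, formEval_sub, formEval_add, formEval_zsmul]
    push_cast
    rfl
  rw [hfib.unique (hasProd_fintype _)]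
  exact Finset.prod_coe_sort B P

/-- Near the origin the gamma function is the exponential of a sum of residues. -/
theorem eventually_Gam_eq_exp (hab : a ⨯₃ b ≠ 0) (hxa : 0 < wt a x) (hxb : 0 < wt b x)
    (hf : IsDualFrame a b c α β (directionVector a b)) (B : Finset (Fin 3 → ℤ))
    (hB : ∀ δ, δ ∈ B ↔ InBox a b c α β (directionVector a b) δ) (o : Fin 3 → ℂ) (k i j : Fin 3)
    (hij : i ≠ j) (hk : Finset.univ.erase k = {i, j}) (hoi : o i = formEval α x)
    (hoj : o j = formEval β x) (hok : o k = formEval (directionVector a b) x) :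
    ∀ᶠ w in 𝓝 (0 : ℂ), (∀ δ ∈ B, Summable (resTerm o (w - formEval δ x) k)) ∧
      Gam a b w x = exp (2 * Real.pi * I * ∑ δ ∈ B, ∑' n, resTerm o (w - formEval δ x) k n) := by
  obtain ⟨s, hs, him⟩ := exists_im_formEval_div hab hxb
  have hi : (o i / o k).im < 0 := by
    have h2 : (0 : ℝ) < (α ⬝ᵥ a : ℤ) := by exact_mod_cast hf.αa
    rw [hoi, hok, him, hf.αb]
    have : 0 < s * wt b x * (α ⬝ᵥ a : ℤ) := by positivity
    simpa using this
  have hj : 0 < (o j / o k).im := by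
    have h2 : (0 : ℝ) < (β ⬝ᵥ b : ℤ) := by exact_mod_cast hf.βb
    rw [hoj, hok, him, hf.βa]
    have : 0 < s * wt a x * (β ⬝ᵥ b : ℤ) := by positivity
    simpa using this
  -- At w = 0 these are the imaginary parts of (β - δ)(x)/γ(x) and (δ - α)(x)/γ(x). They are
  -- strictly positive since δ is positive at a and b; the weak upper bounds of the box suffice.
  have hev : ∀ᶠ w in 𝓝 (0 : ℂ), ∀ δ ∈ B, 0 < ((w - formEval δ x + o j) / o k).im ∧
      0 < ((-(w - formEval δ x) - o i) / o k).im := by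
    rw [Filter.eventually_all_finset]
    intro δ hδ
    obtain ⟨h1, h2, -⟩ := (hB δ).1 hδ
    have c1 : Continuous fun w : ℂ => ((w - formEval δ x + o j) / o k).im := by fun_prop
    have c2 : Continuous fun w : ℂ => ((-(w - formEval δ x) - o i) / o k).im := by fun_prop
    refine (c1.continuousAt.eventually (lt_mem_nhds ?_)).and
      (c2.continuousAt.eventually (lt_mem_nhds ?_))
    · beta_reduce
      have e : 0 - formEval δ x + o j = formEval (β - δ) x := by rw [hoj, formEval_sub]; ring
      rw [e, hok, him, sub_dotProduct, sub_dotProduct, hf.βa]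
      have q1 : (0 : ℝ) < (δ ⬝ᵥ a : ℤ) := by exact_mod_cast h1.1
      have q2 : (0 : ℝ) ≤ ((β ⬝ᵥ b - δ ⬝ᵥ b : ℤ) : ℝ) := by exact_mod_cast sub_nonneg.2 h2.2
      have : 0 < s * wt b x * (δ ⬝ᵥ a : ℤ) := by positivity
      have : 0 ≤ s * wt a x * ((β ⬝ᵥ b - δ ⬝ᵥ b : ℤ) : ℝ) := by positivity
      push_cast at *
      linarith
    · beta_reduce
      have e : -(0 - formEval δ x) - o i = formEval (δ - α) x := by rw [hoi, formEval_sub]; ring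
      rw [e, hok, him, sub_dotProduct, sub_dotProduct, hf.αb]
      have q1 : (0 : ℝ) < (δ ⬝ᵥ b : ℤ) := by exact_mod_cast h2.1
      have q2 : (0 : ℝ) ≤ ((α ⬝ᵥ a - δ ⬝ᵥ a : ℤ) : ℝ) := by exact_mod_cast sub_nonneg.2 h1.2
      have : 0 < s * wt a x * (δ ⬝ᵥ b : ℤ) := by positivity
      have : 0 ≤ s * wt b x * ((α ⬝ᵥ a - δ ⬝ᵥ a : ℤ) : ℝ) := by positivity
      push_cast at *
      linarith
  filter_upwards [hev] with w hw
  choose! S T hS hT hST using fun δ hδ => exists_hasProd_resTerm o (w - formEval δ x) k i j hij hk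
    hi hj (hw δ hδ).1 (hw δ hδ).2
  have hsum : ∀ δ ∈ B, Summable (resTerm o (w - formEval δ x) k) := fun δ hδ =>
    (summable_mul_left_iff two_pi_I_ne_zero).1 (hST δ hδ).summable
  refine ⟨hsum, ?_⟩
  have hN := (admissible_num hab hxa hxb).wedgeProd_eq_prod hf B hB w (fun δ => exp (-S δ))
    fun δ hδ => (hS δ hδ).congr_fun fun p => by
      rw [hoi, hoj, hok]
      congr 2
      push_cast
      ring
  -- The denominator runs over `cone b a`, so α and β exchange roles while the box stays the same.
  have hD := (admissible_den hab hxa hxb).wedgeProd_eq_prod hf.swap B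
    (fun δ => (hB δ).trans InBox.swap.symm) w (fun δ => exp (-T δ))
    fun δ hδ => (hT δ hδ).congr_fun fun p => by
      rw [hoi, hoj, hok]
      congr 2
      push_cast
      ring
  rw [Gam_eq_div hab, hN, hD, ← exp_sum, ← exp_sum, ← exp_sub, ← Finset.sum_sub_distrib,
    Finset.mul_sum]
  congr 1
  refine Finset.sum_congr rfl fun δ hδ => ?_
  rw [← tsum_mul_left, (hST δ hδ).tsum_eq]
  ring

end

/-! ### The periods of a simplicial cone and the coefficients of box points -/

section

open Filter Topology Complex
open scoped Matrix

variable {a b c : Fin 3 → ℤ} {x : Fin 3 → ℂ}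

theorem cross_ne_zero_of_det {a b c : Fin 3 → ℤ} (hdet : 0 < (a ⨯₃ b) ⬝ᵥ c) : a ⨯₃ b ≠ 0 := by
  intro h
  rw [h, zero_dotProduct] at hdet
  exact lt_irrefl _ hdet

theorem det_rotate (a b c : Fin 3 → ℤ) : (b ⨯₃ c) ⬝ᵥ a = (a ⨯₃ b) ⬝ᵥ c := by
  rw [dotProduct_comm, triple_product_permutation, triple_product_permutation, dotProduct_comm]

theorem directionVector_dot_pos (hdet : 0 < (a ⨯₃ b) ⬝ᵥ c) : 0 < directionVector a b ⬝ᵥ c := by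
  obtain ⟨s, hs, hd⟩ := exists_cross_eq_smul (cross_ne_zero_of_det hdet)
  rw [hd, smul_dotProduct, smul_eq_mul] at hdet
  exact (mul_pos_iff_of_pos_left hs).1 hdet

theorem isDualFrame_directionVector (hdet : 0 < (a ⨯₃ b) ⬝ᵥ c) :
    IsDualFrame a b c (directionVector b c) (directionVector c a) (directionVector a b) := by
  have h1 : 0 < (b ⨯₃ c) ⬝ᵥ a := by rwa [det_rotate]
  have h2 : 0 < (c ⨯₃ a) ⬝ᵥ b := by rwa [det_rotate]
  have n0 := cross_ne_zero_of_det hdet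
  have n1 := cross_ne_zero_of_det h1
  have n2 := cross_ne_zero_of_det h2
  exact ⟨directionVector_dot_pos h1, directionVector_dot_left n1, directionVector_dot_right n1,
    directionVector_dot_right n2, directionVector_dot_pos h2, directionVector_dot_left n2,
    directionVector_dot_left n0, directionVector_dot_right n0, directionVector_dot_pos hdet⟩

theorem Admissible.formEval_eq {ε : ℤ} {α β γ : Fin 3 → ℤ} (h : Admissible ε a b γ x)
    (hf : IsDualFrame a b c α β γ) (δ : Fin 3 → ℤ) :
    formEval δ x = ((δ ⬝ᵥ a : ℤ) / (α ⬝ᵥ a : ℤ) : ℂ) * formEval α x +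
      ((δ ⬝ᵥ b : ℤ) / (β ⬝ᵥ b : ℤ) : ℂ) * formEval β x +
      ((δ ⬝ᵥ c : ℤ) / (γ ⬝ᵥ c : ℤ) : ℂ) * formEval γ x := by
  have key : ((α ⬝ᵥ a) * (β ⬝ᵥ b) * (γ ⬝ᵥ c)) • δ = ((β ⬝ᵥ b) * (γ ⬝ᵥ c) * (δ ⬝ᵥ a)) • α +
      ((α ⬝ᵥ a) * (γ ⬝ᵥ c) * (δ ⬝ᵥ b)) • β + ((α ⬝ᵥ a) * (β ⬝ᵥ b) * (δ ⬝ᵥ c)) • γ := by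
    refine h.eq_of_dot_eq hf.γc ?_ ?_ ?_ <;>
      simp only [add_dotProduct, smul_dotProduct, smul_eq_mul, hf.αb, hf.αc, hf.βa, hf.βc, hf.γa,
        hf.γb] <;> ring
  have h1 := congrArg (fun u => formEval u x) key
  simp only [formEval_add, formEval_zsmul] at h1
  have hA : ((α ⬝ᵥ a : ℤ) : ℂ) ≠ 0 := by exact_mod_cast hf.αa.ne'
  have hB : ((β ⬝ᵥ b : ℤ) : ℂ) ≠ 0 := by exact_mod_cast hf.βb.ne'
  have hC : ((γ ⬝ᵥ c : ℤ) : ℂ) ≠ 0 := by exact_mod_cast hf.γc.ne'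
  push_cast at h1
  field_simp
  linear_combination h1

theorem eq_zero_of_im_div_eq_zero {κ u v : ℂ} (hu : (κ / u).im = 0) (hv : (κ / v).im = 0)
    (huv : (u / v).im ≠ 0) : κ = 0 := by
  have hu0 : u ≠ 0 := by rintro rfl; simp at huv
  have h1 : κ / u = ((κ / u).re : ℂ) := Complex.ext rfl (by simpa using hu)
  have h2 : κ / v = ((κ / u).re : ℂ) * (u / v) := by rw [← h1]; field_simp
  rw [h2, im_ofReal_mul] at hv
  rw [(mul_eq_zero.1 hv).resolve_right huv, ofReal_zero] at h1
  exact (div_eq_zero_iff.1 h1).resolve_right hu0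

theorem im_div_eq (u v : ℂ) : (u / v).im = (u * (starRingEnd ℂ) v).im / normSq v := by
  rw [div_eq_mul_inv, inv_def, ← mul_assoc, im_mul_ofReal, div_eq_mul_inv]

theorem im_mul_conj_ne_zero {u v : ℂ} (h : (u / v).im ≠ 0) :
    (u * (starRingEnd ℂ) v).im ≠ 0 ∧ (v * (starRingEnd ℂ) u).im ≠ 0 := by
  rw [im_div_eq] at h
  have h1 : (u * (starRingEnd ℂ) v).im ≠ 0 := fun h0 => h (by rw [h0, zero_div])
  refine ⟨h1, fun h0 => h1 ?_⟩
  simp only [mul_im, conj_re, conj_im] at h0 ⊢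
  linarith

/-- The values at `x` of the three direction vectors of a simplicial cone. -/
noncomputable def frameVal (a b c : Fin 3 → ℤ) (x : Fin 3 → ℂ) : Fin 3 → ℂ :=
  ![formEval (directionVector b c) x, formEval (directionVector c a) x,
    formEval (directionVector a b) x]

/-- The sign of the imaginary parts of the quotients of the values of a dual frame. -/
theorem im_div_frame (hdet : 0 < (a ⨯₃ b) ⬝ᵥ c) (hb : 0 < wt b x) :
    ∃ s > 0,
      (formEval (directionVector b c) x / formEval (directionVector a b) x).im =
        -(s * wt b x * (directionVector b c ⬝ᵥ a : ℤ)) ∧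
      (formEval (directionVector c a) x / formEval (directionVector a b) x).im =
        s * wt a x * (directionVector c a ⬝ᵥ b : ℤ) := by
  have hf := isDualFrame_directionVector hdet
  obtain ⟨s, hs, him⟩ := exists_im_formEval_div (cross_ne_zero_of_det hdet) hb
  refine ⟨s, hs, ?_, ?_⟩
  · rw [him, hf.αb]; simp
  · rw [him, hf.βa]; simp

theorem pairIndep_frameVal (hdet : 0 < (a ⨯₃ b) ⬝ᵥ c) (ha : 0 < wt a x) (hb : 0 < wt b x)
    (hc : 0 < wt c x) : PairIndep (frameVal a b c x) := by
  have hf := isDualFrame_directionVector hdet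
  have hA : (0 : ℝ) < (directionVector b c ⬝ᵥ a : ℤ) := by exact_mod_cast hf.αa
  have hB : (0 : ℝ) < (directionVector c a ⬝ᵥ b : ℤ) := by exact_mod_cast hf.βb
  obtain ⟨s, hs, h1, h2⟩ := im_div_frame hdet hb
  obtain ⟨t, ht, h3, -⟩ := im_div_frame (by rwa [det_rotate] : 0 < (b ⨯₃ c) ⬝ᵥ a) hc
  have p1 := im_mul_conj_ne_zero (h1.trans_ne (by rw [neg_ne_zero]; positivity))
  have p2 := im_mul_conj_ne_zero (h2.trans_ne (by positivity))
  have p3 := im_mul_conj_ne_zero (h3.trans_ne (by rw [neg_ne_zero]; positivity))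
  intro k l hkl
  fin_cases k <;> fin_cases l
  · exact absurd rfl hkl
  · exact p3.2
  · exact p1.1
  · exact p3.1
  · exact absurd rfl hkl
  · exact p2.1
  · exact p1.2
  · exact p2.2
  · exact absurd rfl hkl

/-- The real form with values `wt a x`, `wt b x`, `wt c x` at a, b, c is the pairing with Im x × Re
x, which annihilates x; this is its expansion in the dual frame. The proof compares imaginary parts
of quotients by two independent periods. -/
theorem frameVal_relation (hdet : 0 < (a ⨯₃ b) ⬝ᵥ c) (hb : 0 < wt b x)
    (hc : 0 < wt c x) :
    ((wt a x / (directionVector b c ⬝ᵥ a : ℤ) : ℝ) : ℂ) * formEval (directionVector b c) x +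
      ((wt b x / (directionVector c a ⬝ᵥ b : ℤ) : ℝ) : ℂ) * formEval (directionVector c a) x +
      ((wt c x / (directionVector a b ⬝ᵥ c : ℤ) : ℝ) : ℂ) * formEval (directionVector a b) x = 0 := by
  have hdet' : 0 < (b ⨯₃ c) ⬝ᵥ a := by rwa [det_rotate]
  have hf := isDualFrame_directionVector hdet
  have hA : (0 : ℝ) < (directionVector b c ⬝ᵥ a : ℤ) := by exact_mod_cast hf.αa
  have hB : (0 : ℝ) < (directionVector c a ⬝ᵥ b : ℤ) := by exact_mod_cast hf.βb
  have hC : (0 : ℝ) < (directionVector a b ⬝ᵥ c : ℤ) := by exact_mod_cast hf.γc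
  obtain ⟨s, hs, h1, h2⟩ := im_div_frame hdet hb
  obtain ⟨t, ht, h3, h4⟩ := im_div_frame hdet' hc
  have hg := formEval_directionVector_ne_zero (cross_ne_zero_of_det hdet) hb
  have hg' := formEval_directionVector_ne_zero (cross_ne_zero_of_det hdet') hc
  refine eq_zero_of_im_div_eq_zero (u := formEval (directionVector b c) x)
    (v := formEval (directionVector a b) x) ?_ ?_
    (h1.trans_ne (by rw [neg_ne_zero]; positivity))
  · rw [add_div, add_div, mul_div_assoc, mul_div_assoc, mul_div_assoc, add_im, add_im,
      im_ofReal_mul, im_ofReal_mul, im_ofReal_mul, div_self hg', h3, h4, one_im]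
    field_simp
    ring
  · rw [add_div, add_div, mul_div_assoc, mul_div_assoc, mul_div_assoc, add_im, add_im,
      im_ofReal_mul, im_ofReal_mul, im_ofReal_mul, div_self hg, h1, h2, one_im]
    field_simp
    ring

/-- Near the origin, `w - δ(x)` is minus a combination of the direction vectors with coefficients
in the open unit interval, for `δ` in the half-open box. -/
theorem eventually_exists_coeff (hdet : 0 < (a ⨯₃ b) ⬝ᵥ c) (ha : 0 < wt a x) (hb : 0 < wt b x)
    (hc : 0 < wt c x) {δ : Fin 3 → ℤ} (hδ : InBox a b c (directionVector b c) (directionVector c a)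
      (directionVector a b) δ) :
    ∀ᶠ w in 𝓝 (0 : ℂ), ∃ s : Fin 3 → ℝ, (∀ k, s k ∈ Set.Ioo (0 : ℝ) 1) ∧
      w - formEval δ x = -∑ k, s k * frameVal a b c x k := by
  have hf := isDualFrame_directionVector hdet
  have hA : (0 : ℝ) < (directionVector b c ⬝ᵥ a : ℤ) := by exact_mod_cast hf.αa
  have hB : (0 : ℝ) < (directionVector c a ⬝ᵥ b : ℤ) := by exact_mod_cast hf.βb
  have hC : (0 : ℝ) < (directionVector a b ⬝ᵥ c : ℤ) := by exact_mod_cast hf.γc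
  have hrel := frameVal_relation hdet hb hc
  have heq := (admissible_num (cross_ne_zero_of_det hdet) ha hb).formEval_eq hf δ
  have hind := pairIndep_frameVal hdet ha hb hc 0 1 (by decide)
  obtain ⟨⟨a0, a1⟩, ⟨b0, b1⟩, ⟨c0, c1⟩⟩ := hδ
  have a0' : (0 : ℝ) < (δ ⬝ᵥ a : ℤ) := by exact_mod_cast a0
  have b0' : (0 : ℝ) < (δ ⬝ᵥ b : ℤ) := by exact_mod_cast b0
  have c0' : (0 : ℝ) < (δ ⬝ᵥ c : ℤ) := by exact_mod_cast c0
  have a1' : ((δ ⬝ᵥ a : ℤ) : ℝ) ≤ (directionVector b c ⬝ᵥ a : ℤ) := by exact_mod_cast a1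
  have b1' : ((δ ⬝ᵥ b : ℤ) : ℝ) ≤ (directionVector c a ⬝ᵥ b : ℤ) := by exact_mod_cast b1
  have c1' : ((δ ⬝ᵥ c : ℤ) : ℝ) ≤ (directionVector a b ⬝ᵥ c : ℤ) := by exact_mod_cast c1
  simp only [frameVal, Fin.sum_univ_three, Matrix.cons_val] at hind ⊢
  generalize formEval (directionVector b c) x = p at *
  generalize formEval (directionVector c a) x = q at *
  generalize formEval (directionVector a b) x = r at *
  generalize ((directionVector b c ⬝ᵥ a : ℤ)) = A at *
  generalize ((directionVector c a ⬝ᵥ b : ℤ)) = B at *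
  generalize ((directionVector a b ⬝ᵥ c : ℤ)) = C at *
  set σ : Fin 3 → ℝ := ![(δ ⬝ᵥ a : ℤ) / A, (δ ⬝ᵥ b : ℤ) / B, (δ ⬝ᵥ c : ℤ) / C] with hσ
  set v : Fin 3 → ℝ := ![wt a x / A, wt b x / B, wt c x / C] with hv
  have hσ0 : ∀ k, 0 < σ k := by intro k; fin_cases k <;> simp [hσ] <;> positivity
  have hσ1 : ∀ k, σ k ≤ 1 := by
    intro k
    fin_cases k
    · exact (div_le_one hA).2 a1'
    · exact (div_le_one hB).2 b1'
    · exact (div_le_one hC).2 c1'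
  have hv0 : ∀ k, 0 < v k := by intro k; fin_cases k <;> simp [hv] <;> positivity
  -- The coefficients σ of δ lie in (0,1]. Subtracting a small multiple η of the positive relation v
  -- changes no value and makes them less than 1 while they stay positive.
  obtain ⟨η, hη, hηv⟩ : ∃ η > 0, ∀ k, η * v k < σ k := by
    have h1 : ∀ᶠ η in 𝓝[>] (0 : ℝ), ∀ k, η * v k < σ k := by
      rw [eventually_all]
      intro k
      have hcont : ContinuousAt (fun η : ℝ => η * v k) 0 := by fun_prop
      refine nhdsWithin_le_nhds (hcont.eventually (gt_mem_nhds ?_))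
      simpa using hσ0 k
    obtain ⟨η, h2, h3⟩ := (h1.and self_mem_nhdsWithin).exists
    exact ⟨η, h3, h2⟩
  set d : ℝ := (p * (starRingEnd ℂ) q).im with hd
  -- The terms in w are the real coordinates of w in the basis p, q of ℂ, as `hw'` records.
  set S : ℂ → Fin 3 → ℝ := fun w => ![σ 0 - η * v 0 - (w * (starRingEnd ℂ) q).im / d,
    σ 1 - η * v 1 + (w * (starRingEnd ℂ) p).im / d, σ 2 - η * v 2] with hS
  have hSc : ∀ k, Continuous fun w => S w k := by
    intro k
    fin_cases k <;> simp only [hS] <;> simp <;> fun_prop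
  have hS0 : ∀ k, S 0 k = σ k - η * v k := by intro k; fin_cases k <;> simp [hS]
  have hev : ∀ᶠ w in 𝓝 (0 : ℂ), ∀ k, S w k ∈ Set.Ioo (0 : ℝ) 1 := by
    rw [eventually_all]
    intro k
    refine (hSc k).continuousAt.eventually (isOpen_Ioo.mem_nhds ?_)
    beta_reduce
    rw [hS0]
    exact ⟨by linarith [hηv k], by linarith [hσ1 k, mul_pos hη (hv0 k)]⟩
  filter_upwards [hev] with w hw
  refine ⟨S w, hw, ?_⟩
  have hw' : w = ((w * (starRingEnd ℂ) q).im / d : ℝ) * p - ((w * (starRingEnd ℂ) p).im / d : ℝ) * q := by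
    have hdc : (d : ℂ) ≠ 0 := by exact_mod_cast hind
    push_cast
    field_simp
    apply Complex.ext <;> simp [hd] <;> ring
  simp only [hS, hσ, hv, Matrix.cons_val]
  rw [heq]
  nth_rewrite 1 [hw']
  push_cast at hrel ⊢
  linear_combination (-(η : ℂ)) * hrel

end

/-! ### The three term relation near the origin, its continuation, and the polynomial -/

section

open Filter Topology Complex
open scoped Matrix

variable {a b c : Fin 3 → ℤ} {x : Fin 3 → ℂ}

/-- Each of the three wedges contributes the residues on one line of poles for the same box points,
and for every δ all these residues together give minus the residue at 0. -/
theorem eventually_Gam_three_term (hdet : 0 < (a ⨯₃ b) ⬝ᵥ c) (ha : 0 < wt a x) (hb : 0 < wt b x)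
    (hc : 0 < wt c x) (B : Finset (Fin 3 → ℤ))
    (hB : ∀ δ, δ ∈ B ↔ InBox a b c (directionVector b c) (directionVector c a)
      (directionVector a b) δ) :
    ∀ᶠ w in 𝓝 (0 : ℂ), Gam a b w x * Gam b c w x * Gam c a w x =
      exp (-(2 * Real.pi * I) * ((∑ δ ∈ B, resNum (frameVal a b c x) (w - formEval δ x)) /
        (frameVal a b c x 0 * frameVal a b c x 1 * frameVal a b c x 2))) := by
  have hf := isDualFrame_directionVector hdet
  have hdet1 : 0 < (b ⨯₃ c) ⬝ᵥ a := by rwa [det_rotate]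
  have hdet2 : 0 < (c ⨯₃ a) ⬝ᵥ b := by rwa [det_rotate]
  have h1 := eventually_Gam_eq_exp (cross_ne_zero_of_det hdet) ha hb hf B hB (frameVal a b c x)
    2 0 1 (by decide) (by decide) rfl rfl rfl
  have h2 := eventually_Gam_eq_exp (cross_ne_zero_of_det hdet1) hb hc hf.rotate B
    (fun δ => (hB δ).trans InBox.rotate.symm) (frameVal a b c x)
    0 1 2 (by decide) (by decide) rfl rfl rfl
  have h3 := eventually_Gam_eq_exp (cross_ne_zero_of_det hdet2) hc ha hf.rotate.rotate B
    (fun δ => (hB δ).trans (InBox.rotate.symm.trans InBox.rotate.symm)) (frameVal a b c x)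
    1 2 0 (by decide) (by decide) rfl rfl rfl
  have h4 : ∀ᶠ w in 𝓝 (0 : ℂ), ∀ δ ∈ B, ∃ s : Fin 3 → ℝ, (∀ k, s k ∈ Set.Ioo (0 : ℝ) 1) ∧
      w - formEval δ x = -∑ k, s k * frameVal a b c x k := by
    rw [Filter.eventually_all_finset]
    exact fun δ hδ => eventually_exists_coeff hdet ha hb hc ((hB δ).1 hδ)
  filter_upwards [h1, h2, h3, h4] with w ⟨s1, e1⟩ ⟨s2, e2⟩ ⟨s3, e3⟩ h4
  rw [e1, e2, e3, ← exp_add, ← exp_add, ← mul_add, ← mul_add, neg_mul, ← mul_neg]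
  congr 2
  rw [← Finset.sum_add_distrib, ← Finset.sum_add_distrib, Finset.sum_div, ← Finset.sum_neg_distrib]
  refine Finset.sum_congr rfl fun δ hδ => ?_
  obtain ⟨s, hs, hz⟩ := h4 δ hδ
  have key := sum_tsum_resTerm (pairIndep_frameVal hdet ha hb hc) hs hz fun k => by
    fin_cases k
    · exact s2 δ hδ
    · exact s3 δ hδ
    · exact s1 δ hδ
  rw [← key, Fin.sum_univ_three]
  ring

theorem eq_of_div_eq_near_zero {N D E : ℂ → ℂ} (hN : Differentiable ℂ N) (hD : Differentiable ℂ D)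
    (hE : Differentiable ℂ E) (hE0 : ∀ w, E w ≠ 0) (h : ∀ᶠ w in 𝓝 (0 : ℂ), N w / D w = E w) (w : ℂ)
    (hw : D w ≠ 0) : N w / D w = E w := by
  have h1 : N =ᶠ[𝓝 0] fun w => D w * E w := by
    filter_upwards [h] with u hu
    -- A zero of D would make the quotient 0 by convention, whereas E has no zeros.
    have hDu : D u ≠ 0 := fun h0 => hE0 u (by rw [← hu, h0, div_zero])
    rw [← hu]
    field_simp
  have h2 := AnalyticOnNhd.eq_of_eventuallyEq (z₀ := 0) (fun u _ => hN.analyticAt u)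
    (fun u _ => (hD.mul hE).analyticAt u) h1
  rw [congrFun h2 w]
  simp only [Pi.mul_apply]
  field_simp

theorem resNum_differentiable (o : Fin 3 → ℂ) (z : ℂ) :
    Differentiable ℂ fun w => resNum o (w - z) := by
  unfold resNum
  fun_prop

theorem Gam_three_term_of_det_pos (hdet : 0 < (a ⨯₃ b) ⬝ᵥ c) (ha : 0 < wt a x) (hb : 0 < wt b x)
    (hc : 0 < wt c x) (B : Finset (Fin 3 → ℤ))
    (hB : ∀ δ, δ ∈ B ↔ InBox a b c (directionVector b c) (directionVector c a)
      (directionVector a b) δ) {w : ℂ} (hab : w ∉ zerosPoles a b x) (hbc : w ∉ zerosPoles b c x)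
    (hca : w ∉ zerosPoles c a x) :
    Gam a b w x * Gam b c w x * Gam c a w x =
      exp (-(2 * Real.pi * I) * ((∑ δ ∈ B, resNum (frameVal a b c x) (w - formEval δ x)) /
        (frameVal a b c x 0 * frameVal a b c x 1 * frameVal a b c x 2))) := by
  have nab := cross_ne_zero_of_det hdet
  have nbc : b ⨯₃ c ≠ 0 := cross_ne_zero_of_det (by rwa [det_rotate] : 0 < (b ⨯₃ c) ⬝ᵥ a)
  have nca : c ⨯₃ a ≠ 0 :=
    cross_ne_zero_of_det (by rwa [det_rotate, det_rotate] : 0 < (c ⨯₃ a) ⬝ᵥ b)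
  have hev := eventually_Gam_three_term hdet ha hb hc B hB
  simp only [Gam_eq_div nab, Gam_eq_div nbc, Gam_eq_div nca, div_mul_div_comm] at hev ⊢
  refine eq_of_div_eq_near_zero
    (((admissible_num nab ha hb).differentiable.mul (admissible_num nbc hb hc).differentiable).mul
      (admissible_num nca hc ha).differentiable)
    (((admissible_den nab ha hb).differentiable.mul (admissible_den nbc hb hc).differentiable).mul
      (admissible_den nca hc ha).differentiable) ?_ (fun _ => exp_ne_zero _) hev w ?_
  · have h1 := fun δ : Fin 3 → ℤ => resNum_differentiable (frameVal a b c x) (formEval δ x)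
    fun_prop
  · exact mul_ne_zero (mul_ne_zero (wedgeProd_ne_zero_of_notMem nab ha hb hab).2
      (wedgeProd_ne_zero_of_notMem nbc hb hc hbc).2) (wedgeProd_ne_zero_of_notMem nca hc ha hca).2

/-! ### The polynomial -/

/-- The denominator in lowest terms divides any other denominator, so regularity and value at x can
be read off from any fraction whose denominator is nonzero at x. -/
theorem RatFun.regularAt_and_value {f : RatFun} {n d : MvPolynomial (Fin 3) ℚ}
    (hf : f = algebraMap _ RatFun n / algebraMap _ RatFun d) {x : Fin 3 → ℂ}
    (hd : MvPolynomial.aeval x d ≠ 0) :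
    RatFun.RegularAt f x ∧
      RatFun.value f x = MvPolynomial.aeval x n / MvPolynomial.aeval x d := by
  have hd0 : d ≠ 0 := by rintro rfl; simp at hd
  set N := IsFractionRing.num (MvPolynomial (Fin 3) ℚ) f
  set D := (IsFractionRing.den (MvPolynomial (Fin 3) ℚ) f : MvPolynomial (Fin 3) ℚ)
  have hD0 : D ≠ 0 := nonZeroDivisors.coe_ne_zero _
  have h1 : algebraMap _ RatFun N / algebraMap _ RatFun D = f := by
    rw [← IsFractionRing.mk'_eq_div, IsFractionRing.mk'_num_den]
  have h2 : N * d = n * D := by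
    have hinj := IsFractionRing.injective (MvPolynomial (Fin 3) ℚ) RatFun
    have e1 : algebraMap _ RatFun d ≠ 0 := fun h => hd0 (hinj (by rw [h, map_zero]))
    have e2 : algebraMap _ RatFun D ≠ 0 := fun h => hD0 (hinj (by rw [h, map_zero]))
    rw [hf, div_eq_div_iff e2 e1, ← map_mul, ← map_mul] at h1
    exact hinj h1
  have h3 : D ∣ d := by
    have hrel : IsRelPrime N D := IsFractionRing.num_den_reduced _ f
    exact hrel.symm.dvd_of_dvd_mul_left ⟨n, by rw [h2, mul_comm]⟩
  have h4 : MvPolynomial.aeval x D ≠ 0 := by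
    obtain ⟨e, he⟩ := h3
    intro h0
    rw [he, map_mul, h0, zero_mul] at hd
    exact hd rfl
  refine ⟨h4, ?_⟩
  have h5 := congrArg (MvPolynomial.aeval x) h2
  rw [map_mul, map_mul] at h5
  exact (div_eq_div_iff h4 hd).2 h5

theorem map_resNum {R S : Type*} [CommRing R] [CommRing S] [Algebra ℚ R] [Algebra ℚ S]
    (φ : R →+* S) (o : Fin 3 → R) (z : R) : φ (resNum o z) = resNum (fun k => φ (o k)) (φ z) := by
  simp only [resNum, map_add, map_mul, map_pow, RingHom.map_rat_algebraMap, map_ofNat]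

open Polynomial in
theorem natDegree_resNum_le (o : Fin 3 → MvPolynomial (Fin 3) ℚ) (z : MvPolynomial (Fin 3) ℚ) :
    (resNum (fun k => C (o k)) (X - C z) : (MvPolynomial (Fin 3) ℚ)[X]).natDegree ≤ 3 := by
  have e : ∀ r : ℚ, algebraMap ℚ (MvPolynomial (Fin 3) ℚ)[X] r = C (algebraMap ℚ _ r) :=
    fun r => rfl
  have e3 : (3 : (MvPolynomial (Fin 3) ℚ)[X]) = C 3 := rfl
  simp only [resNum, e, e3, ← C_mul, ← C_add, ← C_pow]
  compute_degree

/-- The linear polynomial of an integral form. -/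
noncomputable def linPoly (δ : Fin 3 → ℤ) : MvPolynomial (Fin 3) ℚ :=
  ∑ i, MvPolynomial.C (δ i : ℚ) * MvPolynomial.X i

theorem aeval_linPoly (δ : Fin 3 → ℤ) (x : Fin 3 → ℂ) :
    MvPolynomial.aeval x (linPoly δ) = formEval δ x := by
  simp [linPoly, formEval]

/-- A polynomial over `ℚ[x₁, x₂, x₃]`, divided by an element of that ring. -/
theorem exists_polyValue (Q : Polynomial (MvPolynomial (Fin 3) ℚ)) (hQ : Q.natDegree ≤ 3)
    (d : MvPolynomial (Fin 3) ℚ) : ∃ P : Polynomial RatFun, P.degree ≤ 3 ∧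
      ∀ x : Fin 3 → ℂ, MvPolynomial.aeval x d ≠ 0 → (∀ k, RatFun.RegularAt (P.coeff k) x) ∧
        ∀ w, polyValue P w x =
          Polynomial.eval₂ (MvPolynomial.aeval x : _ →ₐ[ℚ] ℂ).toRingHom w Q /
            MvPolynomial.aeval x d := by
  set P : Polynomial RatFun := Polynomial.C (algebraMap _ RatFun d)⁻¹ *
    Q.map (algebraMap (MvPolynomial (Fin 3) ℚ) RatFun) with hP
  have hcoeff : ∀ k, P.coeff k = algebraMap _ RatFun (Q.coeff k) / algebraMap _ RatFun d := by
    intro k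
    rw [hP, Polynomial.coeff_C_mul, Polynomial.coeff_map, div_eq_inv_mul]
  have hdeg : P.natDegree ≤ 3 :=
    (Polynomial.natDegree_C_mul_le _ _).trans (Polynomial.natDegree_map_le.trans hQ)
  refine ⟨P, Polynomial.natDegree_le_iff_degree_le.1 hdeg, fun x hd =>
    ⟨fun k => (RatFun.regularAt_and_value (hcoeff k) hd).1, fun w => ?_⟩⟩
  have h0 : RatFun.value 0 x = 0 := by
    have := (RatFun.regularAt_and_value (f := 0) (n := 0) (d := d) (by simp) hd).2
    simpa using this
  rw [polyValue, Polynomial.sum_over_range' P (fun k => by rw [h0, zero_mul]) 4 (by omega),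
    Polynomial.eval₂_eq_sum_range' _ (by omega : Q.natDegree < 4), Finset.sum_div]
  refine Finset.sum_congr rfl fun k _ => ?_
  rw [(RatFun.regularAt_and_value (hcoeff k) hd).2]
  change _ = MvPolynomial.aeval x (Q.coeff k) * w ^ k / _
  ring

/-- The three term relation for positively oriented triples. -/
theorem exists_poly_of_det_pos (hdet : 0 < (a ⨯₃ b) ⬝ᵥ c) :
    ∃ P : Polynomial RatFun, P.degree ≤ 3 ∧ ∀ x, 0 < wt a x → 0 < wt b x → 0 < wt c x →
      (∀ k, RatFun.RegularAt (P.coeff k) x) ∧ ∀ w, w ∉ zerosPoles a b x → w ∉ zerosPoles b c x →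
        w ∉ zerosPoles c a x → Gam a b w x * Gam b c w x * Gam c a w x =
          exp (-(Real.pi * I / 3) * polyValue P w x) := by
  -- A point x₀ serves only to prove the box finite; the box itself depends on a, b, c alone, hence
  -- so does the polynomial.
  by_cases hne : ∃ x, 0 < wt a x ∧ 0 < wt b x
  swap
  · exact ⟨0, by simp, fun x ha hb => absurd ⟨x, ha, hb⟩ hne⟩
  obtain ⟨x₀, ha₀, hb₀⟩ := hne
  have hfin := (admissible_num (cross_ne_zero_of_det hdet) ha₀ hb₀).finite_box
    (isDualFrame_directionVector hdet)
  set B := hfin.toFinset with hBdef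
  have hB : ∀ δ, δ ∈ B ↔ InBox a b c (directionVector b c) (directionVector c a)
      (directionVector a b) δ := fun δ => hfin.mem_toFinset
  set o : Fin 3 → MvPolynomial (Fin 3) ℚ := ![linPoly (directionVector b c),
    linPoly (directionVector c a), linPoly (directionVector a b)] with ho
  have hoe : ∀ x k, MvPolynomial.aeval x (o k) = frameVal a b c x k := by
    intro x k
    fin_cases k <;> simp [ho, frameVal, aeval_linPoly]
  obtain ⟨P, hP, hval⟩ := exists_polyValue
    -- The factor 6 turns 2πi into the normalisation πi/3.
    (∑ δ ∈ B, 6 * resNum (fun k => Polynomial.C (o k)) (Polynomial.X - Polynomial.C (linPoly δ)))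
    (Polynomial.natDegree_sum_le_of_forall_le _ _ fun δ _ =>
      (Polynomial.natDegree_C_mul_le (6 : MvPolynomial (Fin 3) ℚ) _).trans
        (natDegree_resNum_le _ _)) (o 0 * o 1 * o 2)
  refine ⟨P, hP, fun x ha hb hc => ?_⟩
  have hpi := pairIndep_frameVal hdet ha hb hc
  obtain ⟨hreg, hv⟩ := hval x (by
    rw [map_mul, map_mul, hoe, hoe, hoe]
    exact mul_ne_zero (mul_ne_zero (hpi.ne_zero 0) (hpi.ne_zero 1)) (hpi.ne_zero 2))
  refine ⟨hreg, fun w h1 h2 h3 => ?_⟩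
  rw [Gam_three_term_of_det_pos hdet ha hb hc B hB h1 h2 h3, hv]
  congr 1
  have hmap : ∀ δ : Fin 3 → ℤ, Polynomial.eval₂ (MvPolynomial.aeval x : _ →ₐ[ℚ] ℂ).toRingHom w
      (6 * resNum (fun k => Polynomial.C (o k)) (Polynomial.X - Polynomial.C (linPoly δ))) =
      6 * resNum (frameVal a b c x) (w - formEval δ x) := by
    intro δ
    have h := map_resNum (Polynomial.eval₂RingHom (MvPolynomial.aeval x : _ →ₐ[ℚ] ℂ).toRingHom w)
      (fun k => Polynomial.C (o k)) (Polynomial.X - Polynomial.C (linPoly δ))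
    simp only [map_sub, Polynomial.coe_eval₂RingHom, Polynomial.eval₂_C, Polynomial.eval₂_X,
      AlgHom.toRingHom_eq_coe, RingHom.coe_coe, hoe, aeval_linPoly] at h
    rw [Polynomial.eval₂_mul, AlgHom.toRingHom_eq_coe, h, Polynomial.eval₂_ofNat]
  rw [Polynomial.eval₂_finsetSum, Finset.sum_congr rfl fun δ _ => hmap δ, ← Finset.mul_sum,
    map_mul, map_mul, hoe, hoe, hoe]
  ring

theorem polyValue_neg (P : Polynomial RatFun) (hP : P.degree ≤ 3) :
    ∃ P' : Polynomial RatFun, P'.degree ≤ 3 ∧ ∀ x, (∀ k, RatFun.RegularAt (P.coeff k) x) →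
      (∀ k, RatFun.RegularAt (P'.coeff k) x) ∧ ∀ w, polyValue P' w x = -polyValue P w x := by
  have hfrac : ∀ f : RatFun, f = algebraMap _ RatFun (IsFractionRing.num (MvPolynomial (Fin 3) ℚ) f) /
      algebraMap _ RatFun (IsFractionRing.den (MvPolynomial (Fin 3) ℚ) f : MvPolynomial (Fin 3) ℚ) :=
    fun f => by rw [← IsFractionRing.mk'_eq_div, IsFractionRing.mk'_num_den]
  have hneg : ∀ (f : RatFun) x, RatFun.RegularAt f x →
      RatFun.RegularAt (-f) x ∧ RatFun.value (-f) x = -RatFun.value f x := by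
    intro f x hf
    obtain ⟨h1, h2⟩ := RatFun.regularAt_and_value (f := -f)
      (n := -IsFractionRing.num (MvPolynomial (Fin 3) ℚ) f)
      (d := (IsFractionRing.den (MvPolynomial (Fin 3) ℚ) f : MvPolynomial (Fin 3) ℚ))
      (by rw [map_neg, neg_div, ← hfrac]) hf
    exact ⟨h1, by rw [h2, map_neg, neg_div]; rfl⟩
  refine ⟨-P, by rwa [Polynomial.degree_neg], fun x hx => ⟨fun k => ?_, fun w => ?_⟩⟩
  · rw [Polynomial.coeff_neg]
    exact (hneg _ _ (hx k)).1
  · rw [polyValue, polyValue, Polynomial.sum_def, Polynomial.sum_def, Polynomial.support_neg,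
      ← Finset.sum_neg_distrib]
    refine Finset.sum_congr rfl fun k _ => ?_
    rw [Polynomial.coeff_neg, (hneg _ _ (hx k)).2, neg_mul]

theorem regularAt_zero_and_polyValue (x : Fin 3 → ℂ) :
    (∀ k, RatFun.RegularAt ((0 : Polynomial RatFun).coeff k) x) ∧
      ∀ w, polyValue 0 w x = 0 := by
  refine ⟨fun k => ?_, fun w => by simp [polyValue]⟩
  exact (RatFun.regularAt_and_value (f := 0) (n := 0) (d := 1) (by simp) (by simp)).1

theorem exists_poly (hpa : IsPrimitive a) (hpb : IsPrimitive b) (hpc : IsPrimitive c) :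
    ∃ P : Polynomial RatFun, P.degree ≤ 3 ∧ ∀ x, 0 < wt a x → 0 < wt b x → 0 < wt c x →
      (∀ k, RatFun.RegularAt (P.coeff k) x) ∧ ∀ w, w ∉ zerosPoles a b x → w ∉ zerosPoles b c x →
        w ∉ zerosPoles c a x → Gam a b w x * Gam b c w x * Gam c a w x =
          exp (-(Real.pi * I / 3) * polyValue P w x) := by
  rcases lt_trichotomy ((a ⨯₃ b) ⬝ᵥ c) 0 with hdet | hdet | hdet
  · have hdet' : 0 < (b ⨯₃ a) ⬝ᵥ c := by
      rw [← cross_anticomm, neg_dotProduct]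
      omega
    obtain ⟨P, hP, h⟩ := exists_poly_of_det_pos hdet'
    obtain ⟨P', hP', h'⟩ := polyValue_neg P hP
    refine ⟨P', hP', fun x ha hb hc => ?_⟩
    obtain ⟨h1, h2⟩ := h x hb ha hc
    obtain ⟨h1', h2'⟩ := h' x h1
    refine ⟨h1', fun w w1 w2 w3 => ?_⟩
    have nab := cross_swap_ne_zero (cross_ne_zero_of_det hdet')
    have nca : c ⨯₃ a ≠ 0 := cross_swap_ne_zero
      (cross_ne_zero_of_det (by rwa [det_rotate] : 0 < (a ⨯₃ c) ⬝ᵥ b))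
    have nbc : b ⨯₃ c ≠ 0 := cross_swap_ne_zero
      (cross_ne_zero_of_det (by rwa [det_rotate, det_rotate] : 0 < (c ⨯₃ b) ⬝ᵥ a))
    have key := h2 w (by rwa [zerosPoles_swap]) (by rwa [zerosPoles_swap]) (by rwa [zerosPoles_swap])
    -- Reversing the orientation inverts each gamma function, which negates the polynomial.
    rw [Gam_swap nab, Gam_swap nbc, Gam_swap nca] at key
    rw [h2' w, mul_neg, exp_neg, ← key, mul_inv, mul_inv, inv_inv, inv_inv, inv_inv]
    ring
  · refine ⟨0, by simp, fun x ha hb hc => ?_⟩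
    obtain ⟨h1, h2⟩ := regularAt_zero_and_polyValue x
    refine ⟨h1, fun w w1 w2 w3 => ?_⟩
    rw [Gam_three_term_coplanar hpa hpb hpc ha hb hc hdet w1 w2 w3, h2, mul_zero, exp_zero]
  · exact exists_poly_of_det_pos hdet

end

end GammaWedge

theorem mainTheorem2 :
    (∀ a b : Fin 3 → ℤ, GammaWedge.IsPrimitive a → GammaWedge.IsPrimitive b →
      ∀ x ∈ GammaWedge.UPlus a ∩ GammaWedge.UPlus b,
        (∀ w : ℂ, Multipliable (GammaWedge.numFactor a b w x) ∧
          Multipliable (GammaWedge.denFactor a b w x)) ∧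
        Meromorphic (fun w : ℂ => GammaWedge.Gam a b w x) ∧
        (GammaWedge.zerosPoles a b x)ᶜ ∈ Filter.codiscrete ℂ ∧
        ∀ w : ℂ, w ∉ GammaWedge.zerosPoles a b x →
          GammaWedge.Gam a b w x * GammaWedge.Gam b a w x = 1) ∧
    (∀ a b c : Fin 3 → ℤ, GammaWedge.IsPrimitive a → GammaWedge.IsPrimitive b →
      GammaWedge.IsPrimitive c →
      ∃ P : Polynomial GammaWedge.RatFun, P.degree ≤ 3 ∧
        ∀ x ∈ GammaWedge.UPlus a ∩ GammaWedge.UPlus b ∩ GammaWedge.UPlus c,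
          (∀ k : ℕ, GammaWedge.RatFun.RegularAt (P.coeff k) x) ∧
          ∀ w : ℂ, w ∉ GammaWedge.zerosPoles a b x ∪ GammaWedge.zerosPoles b c x ∪
              GammaWedge.zerosPoles c a x →
            GammaWedge.Gam a b w x * GammaWedge.Gam b c w x * GammaWedge.Gam c a w x =
              Complex.exp (-(Real.pi * Complex.I / 3) * GammaWedge.polyValue P w x)) := by
  refine ⟨fun a b ha hb x hx => GammaWedge.Gam_two_term ha hb hx, fun a b c ha hb hc => ?_⟩
  obtain ⟨P, hP, h⟩ := GammaWedge.exists_poly ha hb hc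
  refine ⟨P, hP, fun x hx => ?_⟩
  obtain ⟨h1, h2⟩ := h x (GammaWedge.wt_pos ha.ne_zero hx.1.1) (GammaWedge.wt_pos hb.ne_zero hx.1.2)
    (GammaWedge.wt_pos hc.ne_zero hx.2)
  refine ⟨h1, fun w hw => h2 w (fun h => hw (Or.inl (Or.inl h))) (fun h => hw (Or.inl (Or.inr h)))
    fun h => hw (Or.inr h)⟩
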